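/- **Theorem (reduction of bi-invariant flows on $T^*G$ over $G_R=G_+\times G_-$).** *Setting.* Let $G$ be a connected (finite-dimensional, real, Hausdorff) Lie group with Lie algebra $\mathfrak g$, and let $\mathfrak g=\mathfrak g_+\oplus\mathfrak g_-$ be a decomposition, as a vector space, into two Lie subalgebras, with projections $P_\pm$ and $X_\pm=P_\pm X$. Put $R=P_+-P_-$ and let $\mathfrak g_R$ be the vector space $\mathfrak g$ with the Lie bracket $$[X,Y]_R=\tfrac12\big([RX,Y]+[X,RY]\big)=[X_+,Y_+]-[X_-,Y_-].$$ Let $G_\pm$ be Lie subgroups of $G$ (injectively immersed, not necessarily connected) with Lie algebras $\mathfrak g_\pm$, and put $G_R=G_+\times G_-$. Suppose that the solution $g_\pm\in G_\pm$ of the factorisation problem $g=g_+g_-^{-1}$ is unique whenever it exists, and let $D\subseteq G$ be the set of those $g$ for which it exists ($D=G$ if every element of $G$ factorises). Write $\langle \mathrm{Ad}^*_gL,X\rangle=\langle L,\mathrm{Ad}_{g^{-1}}X\rangle$ and $\langle \mathrm{ad}^*_XL,Y\rangle=-\langle L,[X,Y]\rangle$. For $\varphi\in C^\infty(\mathfrak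 g^*)$ regard $d\varphi(L)$ as an element of $\mathfrak g\simeq(\mathfrak g^*)^*$, and put $$\{\varphi,\psi\}(L)=\langle L,[d\varphi(L),d\psi(L)]\rangle,\qquad \{\varphi,\psi\}_R(L)=\langle L,[d\varphi(L),d\psi(L)]_R\rangle .$$ Identify $T^*G$ with $G\times\mathfrak g^*$ by left translations. Its canonical Poisson bracket is $$\{f,h\}_{T^*G}(g,L)=\partial^if\,\hat e_ih-\partial^ih\,\hat e_if+c_{ij}^kL_k\,\partial^if\,\partial^jh,$$ where $e_i$ is a basis of $\mathfrak g$ with structure constants $c_{ij}^k$, $L=L_ie^i$ in the dual basis, $\partial^i=\partial/\partial L_i$, and $\hat e_i$ are the left invariant vector fields on $G$. The group $G_R$ acts on $T^*G$ by $$(h_+,h_-)\cdot(g,L)=(h_+gh_-^{-1},\ \mathrm{Ad}^*_{h_-}L).$$ Let $H\in C^\infty(\mathfrak g^*)$ be a Casimir function of $\{\cdot,\cdot\}$. Put $\chi_H(g,L)=H(L)$ and $F_t(g,L)=(g\exp(t\,dH(L)),L)$, and let $$s\colon D\times\mathfrak g^*\to\mathfrak g^*,\qquad s(g,L)=\mathrm{Ad}^*_{g_-^{-1}}L,\qquad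 g=g_+g_-^{-1}.$$ *Conclusions.* 1. $\chi_H$ is invariant under the action of $G_R$ on $T^*G$. 2. $D\times\mathfrak g^*$ is stable under $G_R$, and $s$ is constant on the $G_R$-orbits in it. 3. $D$ is open, and $s$ is smooth and surjective; its fibres are exactly the $G_R$-orbits, and every $G_R$-invariant smooth function on $D\times\mathfrak g^*$ is $\varphi\circ s$ for a unique $\varphi\in C^\infty(\mathfrak g^*)$. Thus $s$ is a model of the quotient $(D\times\mathfrak g^*)/G_R\simeq\mathfrak g^*$. The quotient Poisson structure is the Lie–Poisson bracket of $\mathfrak g_R$: $$\{\varphi\circ s,\psi\circ s\}_{T^*G}=\{\varphi,\psi\}_R\circ s\quad\text{on } D\times\mathfrak g^*,\qquad \varphi,\psi\in C^\infty(\mathfrak g^*).$$ 4. $F_t$ is the Hamiltonian flow of $\chi_H$: $F_0=\mathrm{id}$, and $\frac{d}{dt}f(F_t(p))=\{\chi_H,f\}_{T^*G}(F_t(p))$ for all $f\in C^\infty(T^*G)$, $p\in T^*G$ and $t\in\mathbb R$. For $L\in\mathfrak g^*$ let $J_L=\{t\in\mathbb R:\exp(t\,dH(L))\in D\}$. Then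 $J_L$ is open and contains $0$, the solutions $g_\pm(t)\in G_\pm$ of $$\exp(t\,dH(L))=g_+(t)\,g_-(t)^{-1},\qquad t\in J_L,$$ are smooth in $t$ with $g_\pm(0)=e$, and $\mathrm{Ad}^*_{g_+(t)^{-1}}L=\mathrm{Ad}^*_{g_-(t)^{-1}}L=:\bar F_t(L)$. The flow $F_t$ descends to $\bar F_t$: for $p\in D\times\mathfrak g^*$ one has $F_t(p)\in D\times\mathfrak g^*$ if and only if $t\in J_{s(p)}$, and then $s(F_t(p))=\bar F_t(s(p))$. For each of the two signs, $L(t)=\bar F_t(L)$ satisfies on $J_L$ the Lax equation $$\frac{dL}{dt}=-\mathrm{ad}^*_{M_\pm(L)}L,\qquad M_\pm(L)=\tfrac12(R\pm I)(dH(L)).$$ 5. The reduced Hamiltonian is $H$: a function $K$ on $\mathfrak g^*$ satisfies $\chi_H=K\circ s$ on $D\times\mathfrak g^*$ if and only if $K=H$. Moreover $\bar F_t$ is its flow for the bracket of $\mathfrak g_R$: $\frac{d}{dt}\varphi(\bar F_t(L))=\{H,\varphi\}_R(\bar F_t(L))$ for all $\varphi\in C^\infty(\mathfrak g^*)$, $L\in\mathfrak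 g^*$ and $t\in J_L$. -/

import Mathlib

open scoped Manifold ContDiff

noncomputable section

namespace LieReduction

/-- `C^∞` Lie groups satisfy the regularity under which Mathlib constructs the Lie algebra. -/
instance : ENat.LEInfty (minSmoothness ℝ 3) :=
  ⟨by rw [minSmoothness_of_isRCLikeNormedField]; exact ENat.LEInfty.out⟩

section Basic

variable (E : Type*) [NormedAddCommGroup E] [NormedSpace ℝ E]
  (G : Type*) [TopologicalSpace G] [ChartedSpace E G] [Group G]

/-- The Lie algebra `𝔤 = T₁G`. As a vector space it is, by definition of the tangent space, the
model space `E` of `G`. -/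
abbrev Alg : Type _ := GroupLieAlgebra 𝓘(ℝ, E) G

/-- The dual `𝔤*` of the Lie algebra. -/
abbrev Dual : Type _ := StrongDual ℝ E

/-- The cotangent bundle `T*G ≃ G × 𝔤*` in left trivialisation. -/
abbrev Cotangent : Type _ := G × Dual E

variable {E} {G}

/-- The natural pairing `⟨L, X⟩` of `L ∈ 𝔤*` with `X ∈ 𝔤`. -/
def pairing (L : Dual E) (X : Alg E G) : ℝ := L X

/-- `Ad_g X`, the differential at `1` of the conjugation `x ↦ g x g⁻¹`. -/
def Ad (g : G) : E →L[ℝ] E := mfderiv 𝓘(ℝ, E) 𝓘(ℝ, E) (fun x : G => g * x * g⁻¹) 1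

/-- `⟨Ad*_g L, X⟩ = ⟨L, Ad_{g⁻¹} X⟩`. -/
def coAd (g : G) (L : Dual E) : Dual E := L.comp (Ad g⁻¹)

/-- `IsExp X x` says that `x = γ(1)`, where `γ` is the integral curve, starting at the identity, of
the left invariant vector field of `X`. -/
def IsExp (X : Alg E G) (x : G) : Prop :=
  ∃ γ : ℝ → G, γ 0 = 1 ∧ IsMIntegralCurve γ (mulInvariantVectorField X) ∧ γ 1 = x

/-- The exponential map of `G`. -/
def lieExp (X : Alg E G) : G := Classical.epsilon (IsExp X)

variable [FiniteDimensional ℝ E]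

variable (G) in
/-- The differential `dφ(L) ∈ (𝔤*)* ≃ 𝔤` of a function `φ` on `𝔤*`. -/
def dDual (φ : Dual E → ℝ) (L : Dual E) : Alg E G :=
  (Module.evalEquiv ℝ E).symm
    ((fderiv ℝ φ L : Dual E →ₗ[ℝ] ℝ) ∘ₗ
      (LinearMap.toContinuousLinearMap : (E →ₗ[ℝ] ℝ) ≃ₗ[ℝ] (E →L[ℝ] ℝ)).toLinearMap)

/-- The characterisation of `dφ(L)` as an element of `𝔤`. -/
theorem pairing_dDual (φ : Dual E → ℝ) (L η : Dual E) :
    pairing η (dDual G φ L) = fderiv ℝ φ L η := by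
  have h := Module.apply_evalEquiv_symm_apply (R := ℝ) (M := E) (η : E →ₗ[ℝ] ℝ)
    ((fderiv ℝ φ L : Dual E →ₗ[ℝ] ℝ) ∘ₗ
      (LinearMap.toContinuousLinearMap : (E →ₗ[ℝ] ℝ) ≃ₗ[ℝ] (E →L[ℝ] ℝ)).toLinearMap)
  exact h

/-- The Lie-Poisson bracket `⟨L, β(dφ(L), dψ(L))⟩` on functions on `𝔤*` attached to a Lie bracket
`β` on the vector space `𝔤`. -/
def liePoisson (β : Alg E G → Alg E G → Alg E G) (φ ψ : Dual E → ℝ) (L : Dual E) : ℝ :=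
  pairing L (β (dDual G φ L) (dDual G ψ L))

variable (G) in
/-- Casimir functions of the Lie-Poisson bracket of `𝔤`: the smooth functions on `𝔤*` that Poisson
commute with every smooth function. -/
def IsCasimir (H : Dual E → ℝ) : Prop :=
  ContDiff ℝ ∞ H ∧ ∀ ψ : Dual E → ℝ, ContDiff ℝ ∞ ψ →
    ∀ L, liePoisson (fun X Y : Alg E G => ⁅X, Y⁆) H ψ L = 0

/-- The left invariant derivative `(X̂ f)(g, L)`, acting on the `G` variable. -/
def dGroup (f : Cotangent E G → ℝ) (p : Cotangent E G) (X : Alg E G) : ℝ :=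
  mfderiv 𝓘(ℝ, E) 𝓘(ℝ, ℝ) (fun g : G => f (g, p.2)) p.1 (mulInvariantVectorField X p.1)

/-- The differential of `f` at `(g, L)` in the `𝔤*` variable, as an element of `𝔤`. -/
def dFibre (f : Cotangent E G → ℝ) (p : Cotangent E G) : Alg E G :=
  dDual G (fun L => f (p.1, L)) p.2

/-- The canonical Poisson bracket of `T*G` in left trivialisation. In a basis `e_i` of `𝔤`, with
`L = L_i e^i` and structure constants `c_{ij}^k`, it reads
`∂^i f ê_i h - ∂^i h ê_i f + c_{ij}^k L_k ∂^i f ∂^j h`. It is the bracket of the canonical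
symplectic form `dθ`, `θ = ⟨L, g⁻¹ dg⟩`, with `{p, q} = 1` in canonical coordinates. -/
def cotangentBracket (f h : Cotangent E G → ℝ) (p : Cotangent E G) : ℝ :=
  dGroup h p (dFibre f p) - dGroup f p (dFibre h p) + pairing p.2 ⁅dFibre f p, dFibre h p⁆

/-- The linear form `Y ↦ -⟨L, [X, Y]⟩` on `𝔤`. -/
def coadForm [LieGroup 𝓘(ℝ, E) ∞ G] (X : Alg E G) (L : Dual E) : Alg E G →ₗ[ℝ] ℝ where
  toFun Y := -pairing L ⁅X, Y⁆
  map_add' Y Z := by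
    have h : pairing L (⁅X, Y⁆ + ⁅X, Z⁆) = pairing L ⁅X, Y⁆ + pairing L ⁅X, Z⁆ :=
      L.map_add _ _
    rw [lie_add, h, neg_add]
  map_smul' c Y := by
    have h : pairing L (c • ⁅X, Y⁆) = c * pairing L ⁅X, Y⁆ := L.map_smul c _
    rw [lie_smul, h, RingHom.id_apply, smul_eq_mul, mul_neg]

/-- The infinitesimal coadjoint action `⟨ad*_X L, Y⟩ = -⟨L, [X, Y]⟩`. -/
def coad [LieGroup 𝓘(ℝ, E) ∞ G] (X : Alg E G) (L : Dual E) : Dual E :=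
  LinearMap.toContinuousLinearMap (E := E) (coadForm X L)

/-- The lift `χ_H` of a function on `𝔤*` to `T*G`, `χ_H(g, L) = H(L)`. -/
def lift (H : Dual E → ℝ) (p : Cotangent E G) : ℝ := H p.2

/-- The free flow `F_t(g, L) = (g exp(t dH(L)), L)`. -/
def freeFlow (H : Dual E → ℝ) (t : ℝ) (p : Cotangent E G) : Cotangent E G :=
  (p.1 * lieExp (t • dDual G H p.2), p.2)

end Basic

section Splitting

variable {E : Type*} [NormedAddCommGroup E] [NormedSpace ℝ E] [FiniteDimensional ℝ E]
  {G : Type*} [TopologicalSpace G] [ChartedSpace E G] [Group G] [LieGroup 𝓘(ℝ, E) ∞ G]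

/-- The `r`-matrix `R = P₊ - P₋` of a splitting `𝔤 = 𝔤₊ ⊕ 𝔤₋`. -/
def rMatrix {gp gm : LieSubalgebra ℝ (Alg E G)} (hc : IsCompl gp.toSubmodule gm.toSubmodule)
    (X : Alg E G) : Alg E G :=
  Submodule.projection _ _ hc X - Submodule.projection _ _ hc.symm X

/-- `[X, Y]_R = ½ ([R X, Y] + [X, R Y])`, the Lie bracket of `𝔤_R`. -/
def rBracket {gp gm : LieSubalgebra ℝ (Alg E G)} (hc : IsCompl gp.toSubmodule gm.toSubmodule)
    (X Y : Alg E G) : Alg E G :=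
  (1 / 2 : ℝ) • (⁅rMatrix hc X, Y⁆ + ⁅X, rMatrix hc Y⁆)

/-- `K`, with the injective homomorphism `ι`, is a Lie subgroup of `G` with Lie algebra `k`:
`ι` is a smooth immersion, and its differential at the identity has image `k`. -/
structure IsLieSubgroup {F : Type*} [NormedAddCommGroup F] [NormedSpace ℝ F]
    {K : Type*} [TopologicalSpace K] [ChartedSpace F K] [Group K]
    (ι : K →* G) (k : LieSubalgebra ℝ (Alg E G)) : Prop where
  smooth : ContMDiff 𝓘(ℝ, F) 𝓘(ℝ, E) ∞ ι
  injective : Function.Injective ι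
  immersive : Function.Injective (mfderiv 𝓘(ℝ, F) 𝓘(ℝ, E) ι 1)
  range_eq : Set.range (mfderiv 𝓘(ℝ, F) 𝓘(ℝ, E) ι 1 : F → E) = (k : Set (Alg E G))

end Splitting

section Factorisation

variable {E : Type*} [NormedAddCommGroup E] [NormedSpace ℝ E]
  {G : Type*} [TopologicalSpace G] [ChartedSpace E G] [Group G]
  {Gp Gm : Type*} [Group Gp] [Group Gm]

/-- The action `(h₊, h₋) · (g, L) = (h₊ g h₋⁻¹, Ad*_{h₋} L)` of `G_R = G₊ × G₋` on `T*G`. -/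
def act (ιp : Gp →* G) (ιm : Gm →* G) (h : Gp × Gm) (p : Cotangent E G) : Cotangent E G :=
  (ιp h.1 * p.1 * (ιm h.2)⁻¹, coAd (ιm h.2) p.2)

/-- The set of elements `g` of `G` for which the factorisation problem `g = g₊ g₋⁻¹` is
solvable. -/
def factorSet (ιp : Gp →* G) (ιm : Gm →* G) : Set G :=
  {g | ∃ a b, g = ιp a * (ιm b)⁻¹}

/-- The part of `T*G` over the factorisable elements of `G`. -/
def factorDomain (E : Type*) [NormedAddCommGroup E] [NormedSpace ℝ E]
    (ιp : Gp →* G) (ιm : Gm →* G) : Set (G × Dual E) :=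
  factorSet ιp ιm ×ˢ Set.univ

/-- A solution `(g₊, g₋)` of the factorisation problem `g = g₊ g₋⁻¹`, when there is one. -/
def factor (ιp : Gp →* G) (ιm : Gm →* G) (g : G) : Gp × Gm :=
  Classical.epsilon fun h : Gp × Gm => g = ιp h.1 * (ιm h.2)⁻¹

/-- The reduction map `s(g, L) = Ad*_{g₋⁻¹} L`. -/
def redMap (ιp : Gp →* G) (ιm : Gm →* G) (p : Cotangent E G) : Dual E :=
  coAd (ιm (factor ιp ιm p.1).2)⁻¹ p.2

variable [FiniteDimensional ℝ E]

/-- The times `t` for which `exp(t dH(L))` is factorisable. -/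
def factorTimes (ιp : Gp →* G) (ιm : Gm →* G) (H : Dual E → ℝ) (L : Dual E) : Set ℝ :=
  {t | lieExp (t • dDual G H L) ∈ factorSet ιp ιm}

/-- The solution `(g₊(t), g₋(t))` of `exp(t dH(L)) = g₊(t) g₋(t)⁻¹`. -/
def factorCurve (ιp : Gp →* G) (ιm : Gm →* G) (H : Dual E → ℝ) (L : Dual E) (t : ℝ) : Gp × Gm :=
  factor ιp ιm (lieExp (t • dDual G H L))

/-- The reduced flow `L ↦ Ad*_{g₋(t)⁻¹} L`. -/
def redFlow (ιp : Gp →* G) (ιm : Gm →* G) (H : Dual E → ℝ) (t : ℝ) (L : Dual E) : Dual E :=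
  coAd (ιm (factorCurve ιp ιm H L t).2)⁻¹ L

end Factorisation

end LieReduction

end

/-!
Everything rests on two derivatives at the identity of `G`.

* The derivative of `g ↦ Ad g` is `X ↦ [X, ·]` (`exists_hasTangentMap_Ad`). The bracket is defined
  through left invariant vector fields; in a chart it is the antisymmetric part of the mixed second
  derivative of the multiplication (`bracketE_eq_chartMul`), and differentiating `y z = (y z y⁻¹) y`
  identifies this with the derivative of `Ad`. Consequently `⟨L, [X, ·]⟩` is the derivative of
  `x ↦ Ad*_{x⁻¹} L`. A Casimir function `H` satisfies `⟨L, [dH(L), ·]⟩ = 0`; as `G` is connected, it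
  is invariant under the coadjoint action, `dH` is equivariant, and `exp(t dH(L))` fixes `L`.

* The derivative of `x ↦ x₋`, where `x = x₊ x₋⁻¹`, is `-P₋` (`hasTangentMap_factor_snd`). Since
  `𝔤 = 𝔤₊ ⊕ 𝔤₋`, the map `(a, b) ↦ a b⁻¹` is a local diffeomorphism at the identity, so the
  factorisation problem has a smooth local solution there; equivariance under `G_R` and uniqueness
  spread openness and smoothness over the whole set of factorisable elements.

The element `(g₊⁻¹, g₋⁻¹)` of `G_R` carries `(g, L)` to `(1, s(g, L))` (`act_factor_inv`), so that
the fibre over the identity is a section of the orbits. This gives surjectivity, the description of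
the fibres, and the smoothness of the function induced by an invariant one. The same translation,
together with the two derivatives above, gives
`-⟨s(g, L), [P₋ Ad_{g₋}⁻¹ X, ·]⟩` as the left invariant derivative of `s` along `X`
(`hasTangentMap_redMap`); substituting it into the canonical bracket and using that `Ad` preserves
Lie brackets yields the bracket of `𝔤_R` (`cotangentBracket_comp_redMap`).

The free flow commutes with `G_R` because `dH` is equivariant (`freeFlow_act`), hence it descends,
and the reduced flow inherits the flow property (`redFlow_add`). The equation of the reduced flow
therefore needs to be verified only at `t = 0`, where the derivative of `s` gives
`dL/dt = -⟨L, [P₋ dH(L), ·]⟩` (`hasDerivAt_redFlow`). By `⟨L, [dH(L), ·]⟩ = 0` this is the Lax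
equation for either choice of `M`, and also Hamilton's equation for the bracket of `𝔤_R`.
-/

open scoped Topology

namespace LieReduction

/-! ### Tangent maps -/

section TangentMap

variable {E : Type*} [NormedAddCommGroup E] [NormedSpace ℝ E]
  {F : Type*} [NormedAddCommGroup F] [NormedSpace ℝ F]
  {F' : Type*} [NormedAddCommGroup F'] [NormedSpace ℝ F']
  {M : Type*} [TopologicalSpace M] [ChartedSpace E M]
  {N : Type*} [TopologicalSpace N] [ChartedSpace F N]
  {P : Type*} [TopologicalSpace P] [ChartedSpace F' P]

/-- `u'` is the tangent map of `u` at `x`. This is `HasMFDerivAt`, with the tangent spaces replaced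
by the model spaces to which they are definitionally equal, so that derivatives at different points
can be compared and composed as linear maps between fixed spaces. -/
def HasTangentMap (u : N → M) (x : N) (u' : F →L[ℝ] E) : Prop :=
  HasMFDerivAt 𝓘(ℝ, F) 𝓘(ℝ, E) u x u'

theorem HasTangentMap.mfderiv {u : N → M} {x : N} {u' : F →L[ℝ] E}
    (h : HasTangentMap u x u') : (mfderiv 𝓘(ℝ, F) 𝓘(ℝ, E) u x : F →L[ℝ] E) = u' :=
  HasMFDerivAt.mfderiv h

theorem _root_.MDifferentiableAt.hasTangentMap {u : N → M} {x : N}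
    (h : MDifferentiableAt 𝓘(ℝ, F) 𝓘(ℝ, E) u x) :
    HasTangentMap (E := E) (F := F) u x (mfderiv 𝓘(ℝ, F) 𝓘(ℝ, E) u x : F →L[ℝ] E) :=
  h.hasMFDerivAt

theorem _root_.ContMDiffAt.exists_hasTangentMap {u : N → M} {x : N}
    (h : ContMDiffAt 𝓘(ℝ, F) 𝓘(ℝ, E) ∞ u x) : ∃ u' : F →L[ℝ] E, HasTangentMap u x u' :=
  ⟨mfderiv 𝓘(ℝ, F) 𝓘(ℝ, E) u x, (h.mdifferentiableAt (by simp)).hasTangentMap⟩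

theorem HasTangentMap.comp {v : M → P} {u : N → M} {x : N} {y : M} {v' : E →L[ℝ] F'}
    {u' : F →L[ℝ] E} (hv : HasTangentMap v y v') (hu : HasTangentMap u x u') (hy : u x = y) :
    HasTangentMap (fun z => v (u z)) x (v'.comp u') := by
  subst hy
  exact HasMFDerivAt.comp x hv hu

theorem HasTangentMap.unique {u : N → M} {x : N} {u' u'' : F →L[ℝ] E}
    (h : HasTangentMap u x u') (h' : HasTangentMap u x u'') : u' = u'' :=
  hasMFDerivAt_unique h h'

theorem HasTangentMap.congr {u v : N → M} {x : N} {u' : F →L[ℝ] E}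
    (h : HasTangentMap u x u') (h' : v =ᶠ[𝓝 x] u) : HasTangentMap v x u' :=
  HasMFDerivAt.congr_of_eventuallyEq h h'

theorem HasTangentMap.continuousAt {u : N → M} {x : N} {u' : F →L[ℝ] E}
    (h : HasTangentMap u x u') : ContinuousAt u x :=
  HasMFDerivAt.continuousAt h

theorem hasTangentMap_id (x : N) : HasTangentMap (fun y => y) x (ContinuousLinearMap.id ℝ F) :=
  hasMFDerivAt_id x

theorem hasTangentMap_const (c : M) (x : N) :
    HasTangentMap (fun _ : N => c) x (0 : F →L[ℝ] E) :=
  hasMFDerivAt_const c x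

theorem hasTangentMap_iff_hasFDerivAt {u : F → E} {x : F} {u' : F →L[ℝ] E} :
    HasTangentMap u x u' ↔ HasFDerivAt u u' x :=
  hasMFDerivAt_iff_hasFDerivAt

theorem hasTangentMap_extChartAt [IsManifold 𝓘(ℝ, F) 1 N] (x : N) :
    HasTangentMap (extChartAt 𝓘(ℝ, F) x) x (ContinuousLinearMap.id ℝ F) := by
  have h := (mdifferentiableAt_extChartAt (I := 𝓘(ℝ, F)) (mem_chart_source F x)).hasMFDerivAt
  rw [mfderiv_extChartAt_self] at h
  exact h

theorem hasTangentMap_extChartAt_symm [IsManifold 𝓘(ℝ, F) 1 N] (x : N) :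
    HasTangentMap (extChartAt 𝓘(ℝ, F) x).symm (extChartAt 𝓘(ℝ, F) x x)
      (ContinuousLinearMap.id ℝ F) := by
  have h := (mdifferentiableWithinAt_extChartAt_symm (I := 𝓘(ℝ, F))
    (mem_extChartAt_target (I := 𝓘(ℝ, F)) x)).hasMFDerivWithinAt
  rw [mfderivWithin_range_extChartAt_symm, ModelWithCorners.range_eq_univ] at h
  exact hasMFDerivWithinAt_univ.1 h

/-- The curve `γ` has velocity `v` at time `t`, where `v` is read in the model space. -/
def HasVelocity (γ : ℝ → M) (t : ℝ) (v : E) : Prop :=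
  HasTangentMap γ t ((1 : ℝ →L[ℝ] ℝ).smulRight v)

theorem HasTangentMap.comp_velocity {u : M → P} {γ : ℝ → M} {t : ℝ} {x : M} {A : E →L[ℝ] F'}
    {v : E} (hu : HasTangentMap u x A) (hγ : HasVelocity γ t v) (hx : γ t = x) :
    HasVelocity (fun s => u (γ s)) t (A v) := by
  have h := HasTangentMap.comp hu hγ hx
  have e : A.comp ((1 : ℝ →L[ℝ] ℝ).smulRight v) = (1 : ℝ →L[ℝ] ℝ).smulRight (A v) := by
    ext
    simp
  rwa [e] at h

theorem HasVelocity.comp_add {γ : ℝ → M} {t s : ℝ} {v : E} (h : HasVelocity γ (t + s) v) :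
    HasVelocity (fun τ => γ (τ + s)) t v := by
  have h' : HasTangentMap (fun τ : ℝ => τ + s) t (ContinuousLinearMap.id ℝ ℝ) :=
    hasTangentMap_iff_hasFDerivAt.2 ((hasFDerivAt_id t).add_const s)
  exact HasTangentMap.comp h h' rfl

theorem hasVelocity_iff_hasDerivAt {γ : ℝ → E} {t : ℝ} {v : E} :
    HasVelocity γ t v ↔ HasDerivAt γ v t := by
  have e : (1 : ℝ →L[ℝ] ℝ).smulRight v = ContinuousLinearMap.toSpanSingleton ℝ v := by
    ext
    simp
  rw [HasVelocity, hasTangentMap_iff_hasFDerivAt, hasDerivAt_iff_hasFDerivAt, e]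

end TangentMap

/-! ### The adjoint and coadjoint representations -/

section Adjoint

variable {E : Type*} [NormedAddCommGroup E] [NormedSpace ℝ E]
  {G : Type*} [TopologicalSpace G] [ChartedSpace E G] [Group G] [LieGroup 𝓘(ℝ, E) ∞ G]

theorem contMDiff_conj (g : G) : ContMDiff 𝓘(ℝ, E) 𝓘(ℝ, E) ∞ (fun x : G => g * x * g⁻¹) :=
  (contMDiff_const.mul contMDiff_id).mul contMDiff_const

theorem hasTangentMap_conj (g : G) :
    HasTangentMap (fun x : G => g * x * g⁻¹) 1 (Ad (E := E) g) :=
  ((contMDiff_conj (E := E) g).mdifferentiable (by simp) 1).hasTangentMap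

theorem Ad_mul (g h : G) : Ad (E := E) (g * h) = (Ad g).comp (Ad h) := by
  have h1 := (hasTangentMap_conj (E := E) g).comp (hasTangentMap_conj (E := E) h)
    (by simp)
  refine (hasTangentMap_conj (E := E) (g * h)).unique ?_
  convert h1 using 2
  group

theorem Ad_one : Ad (1 : G) = ContinuousLinearMap.id ℝ E := by
  refine (hasTangentMap_conj (E := E) (1 : G)).unique ?_
  simpa using! hasTangentMap_id (1 : G)

theorem Ad_inv_comp (g : G) : (Ad (E := E) g⁻¹).comp (Ad g) = ContinuousLinearMap.id ℝ E := by
  rw [← Ad_mul, inv_mul_cancel, Ad_one]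

theorem coAd_mul (g h : G) (L : Dual E) : coAd (g * h) L = coAd g (coAd h L) := by
  simp [coAd, Ad_mul, ContinuousLinearMap.comp_assoc]

theorem coAd_one (L : Dual E) : coAd (1 : G) L = L := by
  simp [coAd, Ad_one]

theorem contMDiff_Ad :
    ContMDiff 𝓘(ℝ, E) 𝓘(ℝ, E →L[ℝ] E) ∞ (fun g : G => Ad (E := E) g) := by
  intro g₀
  have h := ContMDiffAt.mfderiv (n := ∞) (m := ∞) (I := 𝓘(ℝ, E)) (I' := 𝓘(ℝ, E)) (J := 𝓘(ℝ, E))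
    (x₀ := g₀) (fun g x : G => g * x * g⁻¹) (fun _ => 1)
    (by
      apply ContMDiff.contMDiffAt
      exact (contMDiff_fst.mul contMDiff_snd).mul contMDiff_fst.inv)
    contMDiffAt_const (by simp)
  refine h.congr_of_eventuallyEq ?_
  filter_upwards with g
  -- `x ↦ g x g⁻¹` fixes the identity, so the changes of trivialisation are all from the chart at
  -- the identity to itself
  have key := inTangentCoordinates_eq (I := 𝓘(ℝ, E)) (I' := 𝓘(ℝ, E)) (M := G) (M' := G)
    (fun _ : G => 1) (fun x : G => x * 1 * x⁻¹)
    (fun x : G => Ad (E := E) x) (x₀ := g₀) (x := g) (by simp) (by simp)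
  refine Eq.trans ?_ key.symm
  ext v
  simp only [ContinuousLinearMap.comp_apply]
  have : ∀ (a b c : G), a = b → b = 1 → c = 1 → ∀ w : E,
      (tangentBundleCore 𝓘(ℝ, E) G).coordChange (achart E a) (achart E c) b w = w := by
    rintro a b c rfl rfl rfl w
    rw [VectorBundleCore.coordChange_self _ _ _ (by simp)]
  rw [this _ _ _ rfl rfl rfl, this _ _ _ rfl (by simp) (by simp)]

end Adjoint

/-! ### The Lie bracket in a chart, and the derivative of `Ad` -/

noncomputable section ChartMul

variable {E : Type*} [NormedAddCommGroup E] [NormedSpace ℝ E]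
  {G : Type*} [TopologicalSpace G] [ChartedSpace E G] [Group G]

variable (E G) in
/-- The preferred chart of `G` at the identity. -/
abbrev chartOne : PartialEquiv G E := extChartAt 𝓘(ℝ, E) (1 : G)

variable (E G) in
/-- The coordinates of the identity. -/
abbrev origin : E := chartOne E G 1

variable (E G) in
/-- The multiplication of `G` in the chart at the identity. -/
def chartMul (p : E × E) : E := chartOne E G ((chartOne E G).symm p.1 * (chartOne E G).symm p.2)

variable (G) in
/-- The Lie bracket of `𝔤`, as an operation on the model space of `G`, which is definitionally the
vector space `𝔤`. -/
def bracketE (X Y : E) : E := Bracket.bracket (L := Alg E G) (M := Alg E G) X Y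

variable [LieGroup 𝓘(ℝ, E) ∞ G]

theorem contMDiffAt_chartOne_symm :
    ContMDiffAt 𝓘(ℝ, E) 𝓘(ℝ, E) ∞ (chartOne E G).symm (origin E G) :=
  (contMDiffOn_extChartAt_symm (1 : G)).contMDiffAt (extChartAt_target_mem_nhds 1)

omit [LieGroup 𝓘(ℝ, E) ∞ G] in
theorem chartOne_symm_origin : (chartOne E G).symm (origin E G) = 1 :=
  extChartAt_to_inv (I := 𝓘(ℝ, E)) (1 : G)

theorem contDiffAt_chartMul : ContDiffAt ℝ ∞ (chartMul E G) (origin E G, origin E G) := by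
  rw [← contMDiffAt_iff_contDiffAt]
  have h1 : ContMDiffAt 𝓘(ℝ, E × E) 𝓘(ℝ, E) ∞ (fun p : E × E => (chartOne E G).symm p.1)
      (origin E G, origin E G) :=
    ContMDiffAt.comp (I' := 𝓘(ℝ, E)) (origin E G, origin E G) contMDiffAt_chartOne_symm
      contDiffAt_fst.contMDiffAt
  have h2 : ContMDiffAt 𝓘(ℝ, E × E) 𝓘(ℝ, E) ∞ (fun p : E × E => (chartOne E G).symm p.2)
      (origin E G, origin E G) :=
    ContMDiffAt.comp (I' := 𝓘(ℝ, E)) (origin E G, origin E G) contMDiffAt_chartOne_symm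
      contDiffAt_snd.contMDiffAt
  have h3 := h1.mul h2
  have h4 : ContMDiffAt 𝓘(ℝ, E) 𝓘(ℝ, E) ∞ (chartOne E G)
      ((chartOne E G).symm (origin E G) * (chartOne E G).symm (origin E G)) := by
    rw [chartOne_symm_origin, mul_one]
    exact contMDiffAt_extChartAt
  exact ContMDiffAt.comp (I' := 𝓘(ℝ, E)) (origin E G, origin E G) h4 h3

omit [LieGroup 𝓘(ℝ, E) ∞ G] in
theorem eventually_chartOne_symm_mem :
    ∀ᶠ y in 𝓝 (origin E G), y ∈ (chartOne E G).target :=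
  extChartAt_target_mem_nhds (I := 𝓘(ℝ, E)) (1 : G)

omit [LieGroup 𝓘(ℝ, E) ∞ G] in
theorem chartMul_origin_right {y : E} (hy : y ∈ (chartOne E G).target) :
    chartMul E G (y, origin E G) = y := by
  simp only [chartMul, chartOne_symm_origin, mul_one]
  exact (chartOne E G).right_inv hy

omit [LieGroup 𝓘(ℝ, E) ∞ G] in
theorem chartMul_origin_left {y : E} (hy : y ∈ (chartOne E G).target) :
    chartMul E G (origin E G, y) = y := by
  simp only [chartMul, chartOne_symm_origin, one_mul]
  exact (chartOne E G).right_inv hy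

theorem eventually_hasFDerivAt_chartMul :
    ∀ᶠ p in 𝓝 (origin E G, origin E G),
      HasFDerivAt (chartMul E G) (fderiv ℝ (chartMul E G) p) p := by
  have h : ContDiffAt ℝ 1 (chartMul E G) (origin E G, origin E G) :=
    contDiffAt_chartMul.of_le (by simp)
  filter_upwards [h.eventually (by simp)] with p hp
  exact (hp.differentiableAt (by simp)).hasFDerivAt

theorem fderiv_chartMul_origin (v w : E) :
    fderiv ℝ (chartMul E G) (origin E G, origin E G) (v, w) = v + w := by
  have h := (eventually_hasFDerivAt_chartMul (E := E) (G := G)).self_of_nhds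
  have h1 : HasFDerivAt (fun y => chartMul E G (y, origin E G)) _ (origin E G) :=
    HasFDerivAt.comp (f := fun y => (y, origin E G)) (origin E G) h
      (hasFDerivAt_prodMk_left (origin E G) (origin E G))
  have h2 : HasFDerivAt (fun y => chartMul E G (origin E G, y)) _ (origin E G) :=
    h.comp (origin E G) (hasFDerivAt_prodMk_right (origin E G) (origin E G))
  have h1' : HasFDerivAt (fun y => chartMul E G (y, origin E G)) (ContinuousLinearMap.id ℝ E)
      (origin E G) := (hasFDerivAt_id _).congr_of_eventuallyEq (by
    filter_upwards [eventually_chartOne_symm_mem (E := E) (G := G)] with y hy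
    exact chartMul_origin_right hy)
  have h2' : HasFDerivAt (fun y => chartMul E G (origin E G, y)) (ContinuousLinearMap.id ℝ E)
      (origin E G) := (hasFDerivAt_id _).congr_of_eventuallyEq (by
    filter_upwards [eventually_chartOne_symm_mem (E := E) (G := G)] with y hy
    exact chartMul_origin_left hy)
  have e1 := DFunLike.congr_fun (h1.unique h1') v
  have e2 := DFunLike.congr_fun (h2.unique h2') w
  simp only [ContinuousLinearMap.comp_apply, ContinuousLinearMap.inl_apply,
    ContinuousLinearMap.inr_apply, ContinuousLinearMap.id_apply] at e1 e2
  have : ((v, w) : E × E) = (v, 0) + (0, w) := by simp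
  rw [this, map_add, e1, e2]

/-- In the chart at the identity, the left invariant vector field of `X` at `y` is the derivative
of `z ↦ y z` at the identity in the direction `X`. -/
theorem eventually_chart_mulInvariantVectorField (X : E) :
    ∀ᶠ y in 𝓝 (origin E G),
      (mfderiv 𝓘(ℝ, E) 𝓘(ℝ, E) (chartOne E G) ((chartOne E G).symm y) : E →L[ℝ] E)
        (mulInvariantVectorField (X : Alg E G) ((chartOne E G).symm y)) =
      fderiv ℝ (chartMul E G) (y, origin E G) (0, X) := by
  have hev : ∀ᶠ y in 𝓝 (origin E G),
      HasFDerivAt (chartMul E G) (fderiv ℝ (chartMul E G) (y, origin E G)) (y, origin E G) :=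
    (Continuous.prodMk_left (origin E G)).continuousAt.eventually
      (eventually_hasFDerivAt_chartMul (E := E) (G := G))
  filter_upwards [hev, eventually_chartOne_symm_mem (E := E) (G := G)] with y hy hyt
  set g := (chartOne E G).symm y with hg
  have hgs : g ∈ (chartOne E G).source := (chartOne E G).map_target hyt
  have hgm : MDifferentiableAt 𝓘(ℝ, E) 𝓘(ℝ, E) (chartOne E G) g :=
    mdifferentiableAt_extChartAt (by simpa [extChartAt_source] using hgs)
  have hL : MDifferentiableAt 𝓘(ℝ, E) 𝓘(ℝ, E) (fun x : G => g * x) 1 :=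
    (contMDiff_mul_left (I := 𝓘(ℝ, E)) (n := ∞)).mdifferentiable (by simp) 1
  have h1 := (hgm.hasTangentMap.comp hL.hasTangentMap (mul_one g)).comp
    (hasTangentMap_extChartAt_symm (1 : G)) chartOne_symm_origin
  rw [hasTangentMap_iff_hasFDerivAt] at h1
  have h2 : HasFDerivAt (fun z => chartMul E G (y, z)) _ (origin E G) :=
    hy.comp (origin E G) (hasFDerivAt_prodMk_right y (origin E G))
  exact DFunLike.congr_fun (h1.unique h2) X

/-- The Lie bracket is the antisymmetric part of the mixed second derivative of the multiplication
in a chart. -/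
theorem bracketE_eq_chartMul (X Y : E) :
    bracketE G X Y =
      fderiv ℝ (fun y => fderiv ℝ (chartMul E G) (y, origin E G) (0, Y)) (origin E G) X
      - fderiv ℝ (fun y => fderiv ℝ (chartMul E G) (y, origin E G) (0, X)) (origin E G)
        Y := by
  have key : ∀ Z : E,
      (VectorField.mpullbackWithin 𝓘(ℝ, E) 𝓘(ℝ, E) (chartOne E G).symm
        (mulInvariantVectorField (Z : Alg E G)) (Set.range 𝓘(ℝ, E)) : E → E) =ᶠ[𝓝 (origin E G)]
      (fun y => fderiv ℝ (chartMul E G) (y, origin E G) (0, Z)) := by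
    intro Z
    filter_upwards [eventually_chart_mulInvariantVectorField (G := G) Z,
      eventually_chartOne_symm_mem (E := E) (G := G)] with y hy hyt
    rw [← hy, VectorField.mpullbackWithin_apply]
    have := ContinuousLinearMap.inverse_eq
      (mfderivWithin_extChartAt_symm_comp_mfderiv_extChartAt hyt)
      (mfderiv_extChartAt_comp_mfderivWithin_extChartAt_symm hyt)
    exact DFunLike.congr_fun this _
  -- the bracket of the two fields in the chart is transported back by the derivative of the chart,
  -- which at its own base point is the identity
  have hinv : ∀ w : E,
      (mfderiv 𝓘(ℝ, E) 𝓘(ℝ, E) (chartOne E G) 1 : E →L[ℝ] E).inverse w = w := by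
    have : ∀ A : E →L[ℝ] E, A = ContinuousLinearMap.id ℝ E → ∀ w, A.inverse w = w := by
      rintro A rfl w
      rw [ContinuousLinearMap.inverse_id, ContinuousLinearMap.id_apply]
    exact this _ (hasTangentMap_extChartAt (1 : G)).mfderiv
  have hbr : ∀ (U V U' V' : E → E) (s : Set E) (x : E), s = Set.univ → U =ᶠ[𝓝 x] U' →
      V =ᶠ[𝓝 x] V' → VectorField.lieBracketWithin ℝ U V s x =
        fderiv ℝ V' x (U' x) - fderiv ℝ U' x (V' x) := by
    rintro U V U' V' s x rfl hU hV
    rw [VectorField.lieBracketWithin_univ, hU.lieBracket_vectorField_eq hV,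
      VectorField.lieBracket]
  have hset : (chartOne E G).symm ⁻¹' Set.univ ∩ Set.range 𝓘(ℝ, E) = Set.univ := by simp
  refine (hinv (VectorField.lieBracketWithin ℝ
    (VectorField.mpullbackWithin 𝓘(ℝ, E) 𝓘(ℝ, E) (chartOne E G).symm
        (mulInvariantVectorField (X : Alg E G)) (Set.range 𝓘(ℝ, E)))
    (VectorField.mpullbackWithin 𝓘(ℝ, E) 𝓘(ℝ, E) (chartOne E G).symm
        (mulInvariantVectorField (Y : Alg E G)) (Set.range 𝓘(ℝ, E)))
    ((chartOne E G).symm ⁻¹' Set.univ ∩ Set.range 𝓘(ℝ, E)) (origin E G))).trans ?_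
  refine (hbr _ _ _ _ _ _ hset (key X) (key Y)).trans ?_
  rw [fderiv_chartMul_origin, fderiv_chartMul_origin, zero_add, zero_add]

/-- The derivative at the identity of `g ↦ Ad g` is `X ↦ [X, ·]`. Differentiate the identity
`D₁m(1, g) (Ad g Y) = D₂m(g, 1) Y` for the multiplication `m` in a chart, and use the symmetry
of the second derivative of `m`. -/
theorem exists_hasTangentMap_Ad :
    ∃ A' : E →L[ℝ] E →L[ℝ] E, HasTangentMap (fun g : G => Ad (E := E) g) 1 A' ∧
      ∀ X Y : E, A' X Y = bracketE G X Y := by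
  obtain ⟨A', hA'⟩ := (contMDiff_Ad (E := E) (G := G) 1).exists_hasTangentMap
  refine ⟨A', hA', fun X Y => ?_⟩
  set e := origin E G with he
  set m := chartMul E G with hm
  have hsm : ContDiffAt ℝ ∞ m (e, e) := contDiffAt_chartMul
  have hA : HasFDerivAt (fun y => Ad (E := E) ((chartOne E G).symm y)) A' e :=
    hasTangentMap_iff_hasFDerivAt.1
      (hA'.comp (hasTangentMap_extChartAt_symm (1 : G)) chartOne_symm_origin)
  -- the second derivative of the multiplication
  have hdf : HasFDerivAt (fderiv ℝ m) (fderiv ℝ (fderiv ℝ m) (e, e)) (e, e) :=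
    ((hsm.fderiv_right (m := 1)
      (by rw [one_add_one_eq_two]; exact ENat.LEInfty.out)).differentiableAt (by simp)).hasFDerivAt
  have hsymm := hsm.isSymmSndFDerivAt
    (by rw [minSmoothness_of_isRCLikeNormedField]; exact ENat.LEInfty.out)
  have hl : HasFDerivAt (fun y => fderiv ℝ m (y, e))
      ((fderiv ℝ (fderiv ℝ m) (e, e)).comp (ContinuousLinearMap.inl ℝ E E)) e :=
    HasFDerivAt.comp (f := fun y => (y, e)) e hdf (hasFDerivAt_prodMk_left e e)
  have hr : HasFDerivAt (fun y => fderiv ℝ m (e, y))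
      ((fderiv ℝ (fderiv ℝ m) (e, e)).comp (ContinuousLinearMap.inr ℝ E E)) e :=
    HasFDerivAt.comp (f := fun y => (e, y)) e hdf (hasFDerivAt_prodMk_right e e)
  have hlv : ∀ Z : E, HasFDerivAt (fun y => fderiv ℝ m (y, e) (0, Z)) _ e := fun Z =>
    hl.clm_apply (hasFDerivAt_const ((0 : E), Z) e)
  -- `y z = (y z y⁻¹) y`, differentiated in `z` at the identity
  have hev : ∀ᶠ y in 𝓝 e, fderiv ℝ m (y, e) (0, Y) =
      fderiv ℝ m (e, y) (Ad (E := E) ((chartOne E G).symm y) Y, 0) := by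
    have hev1 : ∀ᶠ y in 𝓝 e, HasFDerivAt m (fderiv ℝ m (y, e)) (y, e) :=
      (Continuous.prodMk_left e).continuousAt.eventually
        (eventually_hasFDerivAt_chartMul (E := E) (G := G))
    have hev2 : ∀ᶠ y in 𝓝 e, HasFDerivAt m (fderiv ℝ m (e, y)) (e, y) :=
      (Continuous.prodMk_right e).continuousAt.eventually
        (eventually_hasFDerivAt_chartMul (E := E) (G := G))
    filter_upwards [hev1, hev2, eventually_chartOne_symm_mem (E := E) (G := G)] with y hy1 hy2 hyt
    set g := (chartOne E G).symm y with hg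
    have h1 : HasFDerivAt (fun z => m (y, z)) _ e := hy1.comp e (hasFDerivAt_prodMk_right y e)
    have hc : HasTangentMap (fun z => chartOne E G (g * (chartOne E G).symm z * g⁻¹)) e
        ((ContinuousLinearMap.id ℝ E).comp
          ((Ad (E := E) g).comp (ContinuousLinearMap.id ℝ E))) :=
      (hasTangentMap_extChartAt (1 : G)).comp
        ((hasTangentMap_conj (E := E) g).comp (hasTangentMap_extChartAt_symm (1 : G))
          chartOne_symm_origin) (by
            change g * (chartOne E G).symm (origin E G) * g⁻¹ = 1
            rw [chartOne_symm_origin]; group)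
    rw [hasTangentMap_iff_hasFDerivAt, ContinuousLinearMap.id_comp,
      ContinuousLinearMap.comp_id] at hc
    have hce : chartOne E G (g * (chartOne E G).symm e * g⁻¹) = e := by
      rw [he, chartOne_symm_origin, mul_one, mul_inv_cancel]
    have h2 : HasFDerivAt (fun z => m (chartOne E G (g * (chartOne E G).symm z * g⁻¹), y)) _ e :=
      HasFDerivAt.comp (f := fun z => (chartOne E G (g * (chartOne E G).symm z * g⁻¹), y))
        (g := m) (g' := fderiv ℝ m (e, y)) e (by rw [hce]; exact hy2)
        (hc.prodMk (hasFDerivAt_const y e))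
    have hsrc : ∀ᶠ z in 𝓝 e, g * (chartOne E G).symm z * g⁻¹ ∈ (chartOne E G).source := by
      have hcont : ContinuousAt (fun z => g * (chartOne E G).symm z * g⁻¹) e :=
        ((hasTangentMap_conj (E := E) g).comp (hasTangentMap_extChartAt_symm (1 : G))
          chartOne_symm_origin).continuousAt
      refine hcont.eventually_mem ?_
      rw [he, chartOne_symm_origin, mul_one, mul_inv_cancel]
      exact extChartAt_source_mem_nhds (I := 𝓘(ℝ, E)) (1 : G)
    have h3 := h2.congr_of_eventuallyEq (f₁ := fun z => m (y, z)) (by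
      filter_upwards [hsrc] with z hz
      simp only [hm, chartMul]
      rw [(chartOne E G).left_inv hz, ← hg]
      congr 1
      group)
    have := DFunLike.congr_fun (h1.unique h3) Y
    exact this
  have hR : HasFDerivAt (fun y => fderiv ℝ m (e, y) (Ad (E := E) ((chartOne E G).symm y) Y, 0)) _
      e := hr.clm_apply ((hA.clm_apply (hasFDerivAt_const Y e)).prodMk
        (hasFDerivAt_const (0 : E) e))
  have hfin := DFunLike.congr_fun ((hlv Y).unique (hR.congr_of_eventuallyEq hev)) X
  rw [bracketE_eq_chartMul, (hlv X).fderiv, (hlv Y).fderiv]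
  have hs := hsymm (0, X) (Y, 0)
  have hAe : Ad (E := E) ((chartOne E G).symm e) = ContinuousLinearMap.id ℝ E := by
    rw [he, chartOne_symm_origin, Ad_one]
  have hme : fderiv ℝ m (e, e) (A' X Y, 0) = A' X Y := by
    rw [hm, fderiv_chartMul_origin, add_zero]
  simp only [add_apply, ContinuousLinearMap.comp_apply,
    ContinuousLinearMap.flip_apply, zero_apply, map_zero,
    ContinuousLinearMap.inl_apply, ContinuousLinearMap.inr_apply, ContinuousLinearMap.prod_apply,
    zero_add, ContinuousLinearMap.id_apply, hAe, hme] at hfin hs ⊢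
  rw [hfin, hs, add_sub_cancel_right]

end ChartMul

noncomputable section AdjointBracket

variable {E : Type*} [NormedAddCommGroup E] [NormedSpace ℝ E]
  {G : Type*} [TopologicalSpace G] [ChartedSpace E G] [Group G] [LieGroup 𝓘(ℝ, E) ∞ G]

variable (E G) in
/-- The Lie bracket `X ↦ [X, ·]` as a continuous bilinear map, obtained as the derivative of `Ad` at
the identity. -/
def bracketL : E →L[ℝ] E →L[ℝ] E := (exists_hasTangentMap_Ad (E := E) (G := G)).choose

theorem hasTangentMap_Ad_one : HasTangentMap (fun g : G => Ad (E := E) g) 1 (bracketL E G) :=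
  (exists_hasTangentMap_Ad (E := E) (G := G)).choose_spec.1

theorem bracketL_apply (X Y : E) : bracketL E G X Y = bracketE G X Y :=
  (exists_hasTangentMap_Ad (E := E) (G := G)).choose_spec.2 X Y

omit [LieGroup 𝓘(ℝ, E) ∞ G] in
theorem bracketE_skew (X Y : E) : bracketE G X Y = -bracketE G Y X :=
  VectorField.mlieBracket_swap_apply

theorem bracketL_skew (X Y : E) : bracketL E G X Y = -bracketL E G Y X := by
  rw [bracketL_apply, bracketL_apply, bracketE_skew]

/-- `Ad g` is an automorphism of the Lie algebra: differentiate `Ad (g x g⁻¹) = Ad g Ad x Ad g⁻¹`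
at `x = 1`. -/
theorem Ad_bracketL (g : G) (X Y : E) :
    Ad g (bracketL E G X Y) = bracketL E G (Ad g X) (Ad g Y) := by
  have h1 : HasTangentMap (fun x : G => Ad (E := E) (g * x * g⁻¹)) 1
      ((bracketL E G).comp (Ad g)) :=
    hasTangentMap_Ad_one.comp (hasTangentMap_conj (E := E) g) (by simp)
  have hΦ : HasTangentMap (fun T : E →L[ℝ] E => ((Ad (E := E) g).comp T).comp (Ad g⁻¹))
      (Ad (1 : G)) (((ContinuousLinearMap.compL ℝ E E E).flip (Ad g⁻¹)).comp
        (ContinuousLinearMap.compL ℝ E E E (Ad g))) :=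
    hasTangentMap_iff_hasFDerivAt.2
      (((ContinuousLinearMap.compL ℝ E E E).flip (Ad g⁻¹)).comp
        (ContinuousLinearMap.compL ℝ E E E (Ad g))).hasFDerivAt
  have h2 := hΦ.comp (hasTangentMap_Ad_one (E := E) (G := G)) rfl
  have heq : (fun x : G => ((Ad (E := E) g).comp (Ad x)).comp (Ad g⁻¹)) =
      fun x : G => Ad (E := E) (g * x * g⁻¹) := by
    funext x
    rw [Ad_mul, Ad_mul]
  rw [heq] at h2
  have h3 := DFunLike.congr_fun (DFunLike.congr_fun (h1.unique h2) X) (Ad g Y)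
  have h4 : Ad (E := E) g⁻¹ (Ad g Y) = Y := DFunLike.congr_fun (Ad_inv_comp (E := E) g) Y
  simp only [ContinuousLinearMap.comp_apply, ContinuousLinearMap.flip_apply,
    ContinuousLinearMap.compL_apply, h4] at h3
  exact h3.symm

end AdjointBracket

/-! ### Left invariant fields and the exponential map -/

noncomputable section Exponential

variable {E : Type*} [NormedAddCommGroup E] [NormedSpace ℝ E]
  {G : Type*} [TopologicalSpace G] [ChartedSpace E G] [Group G]

/-- The left invariant vector field of `X`, with values in the model space. -/
def leftField (X : E) (g : G) : E := mulInvariantVectorField (I := 𝓘(ℝ, E)) (X : Alg E G) g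

/-- `γ` is an integral curve of the left invariant vector field of `X`. -/
def IsLeftCurve (X : E) (γ : ℝ → G) : Prop :=
  ∀ t, HasVelocity γ t (leftField X (γ t))

variable [LieGroup 𝓘(ℝ, E) ∞ G]

theorem mdifferentiableAt_mul_left (g h : G) :
    MDifferentiableAt 𝓘(ℝ, E) 𝓘(ℝ, E) (fun x : G => g * x) h :=
  (contMDiff_mul_left (I := 𝓘(ℝ, E)) (n := ∞)).mdifferentiable (by simp) h

theorem exists_hasTangentMap_mul_left (g h : G) :
    ∃ A : E →L[ℝ] E, HasTangentMap (fun x : G => g * x) h A :=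
  ⟨_, (mdifferentiableAt_mul_left g h).hasTangentMap⟩

omit [LieGroup 𝓘(ℝ, E) ∞ G] in
theorem HasTangentMap.leftField {g : G} {A : E →L[ℝ] E}
    (hA : HasTangentMap (fun x : G => g * x) 1 A) (X : E) : LieReduction.leftField X g = A X :=
  DFunLike.congr_fun (HasTangentMap.mfderiv hA) X

omit [LieGroup 𝓘(ℝ, E) ∞ G] in
theorem leftField_one (X : E) : leftField X (1 : G) = X := by
  have h : HasTangentMap (fun x : G => 1 * x) 1 (ContinuousLinearMap.id ℝ E) := by
    simpa using! hasTangentMap_id (1 : G)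
  exact h.leftField X

/-- The field of `X` is left invariant. -/
theorem HasTangentMap.leftField_mul {g h : G} {A : E →L[ℝ] E}
    (hA : HasTangentMap (fun x : G => g * x) h A) (X : E) :
    A (LieReduction.leftField X h) = LieReduction.leftField X (g * h) := by
  have hB := (mdifferentiableAt_mul_left (E := E) h 1).hasTangentMap
  have hC := hA.comp hB (mul_one h)
  simp only [← mul_assoc] at hC
  rw [hC.leftField, hB.leftField]
  rfl

theorem HasVelocity.mul_left {X : E} {γ : ℝ → G} {t : ℝ} (g : G)
    (h : HasVelocity γ t (LieReduction.leftField X (γ t))) :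
    HasVelocity (fun s => g * γ s) t (LieReduction.leftField X (g * γ t)) := by
  have hA := (mdifferentiableAt_mul_left (E := E) g (γ t)).hasTangentMap
  rw [← hA.leftField_mul]
  exact hA.comp_velocity h rfl

theorem IsLeftCurve.mul_left {X : E} {γ : ℝ → G} (h : IsLeftCurve X γ) (g : G) :
    IsLeftCurve X (fun t => g * γ t) := fun t => (h t).mul_left g

/-- Conjugation maps the left invariant field of `X` to that of `Ad g X`. -/
theorem IsLeftCurve.conj {X : E} {γ : ℝ → G} (h : IsLeftCurve X γ) (g : G) :
    IsLeftCurve (Ad g X) (fun t => g * γ t * g⁻¹) := by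
  intro t
  -- `g γ(s) g⁻¹ = (g γ(t) g⁻¹) * (g (γ(t)⁻¹ γ(s)) g⁻¹)`, and the last factor passes through `1`
  have h1 : HasVelocity (fun s => (γ t)⁻¹ * γ s) t X := by
    have := (h t).mul_left (γ t)⁻¹
    rwa [inv_mul_cancel, leftField_one] at this
  have h2 : HasVelocity (fun s => g * ((γ t)⁻¹ * γ s) * g⁻¹) t (Ad g X) :=
    (hasTangentMap_conj (E := E) g).comp_velocity h1 (by simp)
  have h3 := HasVelocity.mul_left (X := Ad g X) (γ := fun s => g * ((γ t)⁻¹ * γ s) * g⁻¹)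
    (t := t) (g * γ t * g⁻¹) (by simpa [leftField_one] using h2)
  simpa [mul_assoc] using h3

theorem contMDiff_leftField (X : E) : ContMDiff 𝓘(ℝ, E) 𝓘(ℝ, E).tangent 1
    (fun g : G => (⟨g, mulInvariantVectorField (X : Alg E G) g⟩ : TangentBundle 𝓘(ℝ, E) G)) := by
  have : LieGroup 𝓘(ℝ, E) (minSmoothness ℝ 3) G := inferInstance
  refine (contMDiff_mulInvariantVectorField (I := 𝓘(ℝ, E)) (G := G) X).of_le ?_
  rw [minSmoothness_of_isRCLikeNormedField]
  exact one_le_two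

variable [T2Space G] [CompleteSpace E]

omit [CompleteSpace E] in
theorem IsLeftCurve.eq {X : E} {γ γ' : ℝ → G} (h : IsLeftCurve X γ) (h' : IsLeftCurve X γ')
    {t : ℝ} (ht : γ t = γ' t) : γ = γ' := by
  exact isMIntegralCurve_Ioo_eq_of_contMDiff_boundaryless (I := 𝓘(ℝ, E)) (t₀ := t)
    (contMDiff_leftField X) h h' ht

/-- Left invariant vector fields are complete: by left translation, the integral curve through every
point exists for the same time as the one through the identity. -/
theorem exists_isLeftCurve (X : E) : ∃ γ : ℝ → G, γ 0 = 1 ∧ IsLeftCurve X γ := by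
  obtain ⟨γ, hγ0, hγ⟩ := exists_isMIntegralCurveAt_of_contMDiffAt_boundaryless
    (I := 𝓘(ℝ, E)) 0 (contMDiff_leftField X (1 : G))
  obtain ⟨ε, hε, hγε⟩ := isMIntegralCurveAt_iff'.1 hγ
  refine exists_isMIntegralCurve_of_isMIntegralCurveOn (contMDiff_leftField X) hε (fun g => ?_) 1
  refine ⟨fun t => g * γ t, by simp [hγ0], fun t ht => ?_⟩
  have hb : Metric.ball (0 : ℝ) ε = Set.Ioo (-ε) ε := by simp [Real.ball_eq_Ioo]
  have h1 : HasVelocity γ t (leftField X (γ t)) :=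
    (hγε t (by rwa [hb])).hasMFDerivAt (by rw [hb]; exact isOpen_Ioo.mem_nhds ht)
  exact HasMFDerivAt.hasMFDerivWithinAt (h1.mul_left g)

omit [CompleteSpace E] in
/-- Integral curves exist and are unique, so the chosen value `lieExp X` is the expected one. -/
theorem lieExp_eq {X : E} {γ : ℝ → G} (h : IsLeftCurve X γ) (h0 : γ 0 = 1) :
    lieExp (X : Alg E G) = γ 1 := by
  have hex : ∃ x, IsExp (X : Alg E G) x := ⟨γ 1, γ, h0, h, rfl⟩
  obtain ⟨γ', h0', h', h1'⟩ := Classical.epsilon_spec hex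
  have : γ' = γ := IsLeftCurve.eq (X := X) h' h (t := 0) (h0'.trans h0.symm)
  rw [← this]
  exact h1'.symm

omit [T2Space G] [CompleteSpace E] in
theorem IsLeftCurve.comp_mul {X : E} {γ : ℝ → G} (h : IsLeftCurve X γ) (a : ℝ) :
    IsLeftCurve (a • X) (fun t => γ (t * a)) := by
  intro t
  have h1 : HasVelocity (fun s : ℝ => s * a) t a :=
    hasVelocity_iff_hasDerivAt.2 (by simpa using (hasDerivAt_id t).mul_const a)
  have h2 := HasTangentMap.comp_velocity (h (t * a)) h1 rfl
  have e : leftField (a • X) (γ (t * a)) = a • leftField X (γ (t * a)) := by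
    obtain ⟨A, hA⟩ := exists_hasTangentMap_mul_left (E := E) (γ (t * a)) 1
    rw [hA.leftField, hA.leftField, map_smul]
  rw [e]
  simpa using h2

omit [CompleteSpace E] in
theorem IsLeftCurve.eq_lieExp {X : E} {γ : ℝ → G} (h : IsLeftCurve X γ) (h0 : γ 0 = 1) (t : ℝ) :
    lieExp (t • X : Alg E G) = γ t := by
  have := lieExp_eq (h.comp_mul t) (by simpa using h0)
  simpa using! this

theorem isLeftCurve_lieExp (X : E) : IsLeftCurve X (fun t : ℝ => lieExp (G := G) (t • X)) := by
  obtain ⟨γ, h0, h⟩ := exists_isLeftCurve (G := G) X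
  convert h using 1
  funext t
  exact h.eq_lieExp h0 t

theorem lieExp_zero_smul (X : E) : lieExp (G := G) ((0 : ℝ) • X) = 1 := by
  obtain ⟨γ, h0, h⟩ := exists_isLeftCurve (G := G) X
  rw [← h0]
  exact h.eq_lieExp h0 0

theorem lieExp_add_smul (X : E) (s t : ℝ) :
    lieExp (G := G) ((s + t) • X) = lieExp (G := G) (s • X) * lieExp (G := G) (t • X) := by
  have h1 : IsLeftCurve X (fun τ : ℝ => lieExp (G := G) ((τ + s) • X)) :=
    fun τ => (isLeftCurve_lieExp X (τ + s)).comp_add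
  have h2 := (isLeftCurve_lieExp (G := G) X).mul_left (lieExp (G := G) (s • X))
  have := congrFun (h1.eq h2 (t := 0) (by
    rw [lieExp_zero_smul, zero_add, mul_one])) t
  rw [add_comm s t]
  exact this

theorem lieExp_Ad (g : G) (X : E) (t : ℝ) :
    lieExp (G := G) (t • Ad g X) = g * lieExp (G := G) (t • X) * g⁻¹ :=
  ((isLeftCurve_lieExp (G := G) X).conj g).eq_lieExp (by
    rw [lieExp_zero_smul, mul_one, mul_inv_cancel]) t

theorem hasVelocity_lieExp_zero (X : E) :
    HasVelocity (fun t : ℝ => lieExp (G := G) (t • X)) 0 X := by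
  have h : HasVelocity _ 0 (leftField X (lieExp (G := G) ((0 : ℝ) • X))) :=
    isLeftCurve_lieExp (G := G) X 0
  rwa [lieExp_zero_smul, leftField_one] at h

omit [CompleteSpace E] in
/-- A solution of `y' = Ψ(y)` is as smooth as `Ψ`: bootstrap from continuity. -/
theorem contDiffAt_of_hasDerivAt_comp {y : ℝ → E} {Ψ : E → E} {t : ℝ}
    (hy : ∀ᶠ s in 𝓝 t, HasDerivAt y (Ψ (y s)) s) (hΨ : ContDiffAt ℝ ∞ Ψ (y t)) :
    ContDiffAt ℝ ∞ y t := by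
  rw [contDiffAt_infty]
  intro n
  induction n with
  | zero =>
    exact contDiffAt_zero.2 ⟨_, hy, fun s hs => hs.continuousAt.continuousWithinAt⟩
  | succ n ih =>
    refine contDiffAt_succ_iff_hasFDerivAt.2
      ⟨fun s => ContinuousLinearMap.toSpanSingleton ℝ (Ψ (y s)), ⟨_, hy, fun s hs =>
        hs.hasFDerivAt⟩, ?_⟩
    have h1 : ContDiffAt ℝ n (fun s => Ψ (y s)) t := (contDiffAt_infty.1 hΨ n).comp t ih
    exact (ContinuousLinearMap.toSpanSingletonCLE (𝕜 := ℝ) (E := E)).contDiff.contDiffAt.comp t h1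

/-- One-parameter subgroups are smooth: near `0` by regularity of solutions of differential
equations in a chart, elsewhere by translation. -/
theorem contMDiff_lieExp_smul (X : E) :
    ContMDiff 𝓘(ℝ, ℝ) 𝓘(ℝ, E) ∞ (fun t : ℝ => lieExp (G := G) (t • X)) := by
  set γ : ℝ → G := fun t => lieExp (G := G) (t • X) with hγ
  have hL : IsLeftCurve X γ := isLeftCurve_lieExp X
  have hγ0 : γ 0 = 1 := lieExp_zero_smul X
  have hcont : ContinuousAt γ 0 := (hL 0).continuousAt
  -- in the chart at the identity, `γ` solves the differential equation of the left invariant field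
  have h0 : ContMDiffAt 𝓘(ℝ, ℝ) 𝓘(ℝ, E) ∞ γ 0 := by
    have hsrc : ∀ᶠ t in 𝓝 (0 : ℝ), γ t ∈ (chartOne E G).source := by
      refine hcont.eventually_mem ?_
      rw [hγ0]
      exact extChartAt_source_mem_nhds (I := 𝓘(ℝ, E)) (1 : G)
    have hyc : ContinuousAt (fun t => chartOne E G (γ t)) 0 :=
      ContinuousAt.comp (g := chartOne E G)
        (by rw [hγ0]; exact continuousAt_extChartAt (I := 𝓘(ℝ, E)) (1 : G)) hcont
    have hfield := eventually_chart_mulInvariantVectorField (G := G) X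
    have hy0 : chartOne E G (γ 0) = origin E G := by rw [hγ0]
    have hy : ContDiffAt ℝ ∞ (fun t => chartOne E G (γ t)) 0 := by
      refine contDiffAt_of_hasDerivAt_comp
        (Ψ := fun y => fderiv ℝ (chartMul E G) (y, origin E G) (0, X)) ?_ ?_
      · rw [← hy0] at hfield
        filter_upwards [hsrc, hyc.eventually hfield] with t ht hft
        have hinv : (chartOne E G).symm (chartOne E G (γ t)) = γ t := (chartOne E G).left_inv ht
        have hm : MDifferentiableAt 𝓘(ℝ, E) 𝓘(ℝ, E) (chartOne E G) (γ t) :=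
          mdifferentiableAt_extChartAt (by simpa [extChartAt_source] using ht)
        have hv := hm.hasTangentMap.comp_velocity (hL t) rfl
        rw [hinv, hγ0] at hft
        rw [← hasVelocity_iff_hasDerivAt, ← hft]
        exact hv
      · rw [hy0]
        have h1 : ContDiffAt ℝ ∞ (fderiv ℝ (chartMul E G)) (origin E G, origin E G) :=
          contDiffAt_chartMul.fderiv_right (by simp)
        have h2 : ContDiffAt ℝ ∞ (fun y => fderiv ℝ (chartMul E G) (y, origin E G)) (origin E G) :=
          ContDiffAt.comp (origin E G) (g := fderiv ℝ (chartMul E G))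
            (f := fun y => (y, origin E G)) h1 (contDiffAt_id.prodMk contDiffAt_const)
        exact h2.clm_apply contDiffAt_const
    have h3 : ContMDiffAt 𝓘(ℝ, ℝ) 𝓘(ℝ, E) ∞
        (fun t => (chartOne E G).symm (chartOne E G (γ t))) 0 :=
      ContMDiffAt.comp (I' := 𝓘(ℝ, E)) (g := (chartOne E G).symm) 0
        (by rw [hy0]; exact contMDiffAt_chartOne_symm) hy.contMDiffAt
    refine h3.congr_of_eventuallyEq ?_
    filter_upwards [hsrc] with t ht
    exact ((chartOne E G).left_inv ht).symm
  intro t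
  have h4 : γ = fun s => γ t * γ (s - t) := by
    funext s
    have := lieExp_add_smul (G := G) X t (s - t)
    rwa [add_sub_cancel] at this
  rw [h4]
  refine contMDiffAt_const.mul (ContMDiffAt.comp (I' := 𝓘(ℝ, ℝ)) (g := γ) t ?_ ?_)
  · rw [sub_self]; exact h0
  · exact (contDiff_id.sub contDiff_const).contMDiff.contMDiffAt

end Exponential

/-! ### The coadjoint action and Casimir functions -/

noncomputable section Casimir

variable {E : Type*} [NormedAddCommGroup E] [NormedSpace ℝ E]
  {G : Type*} [TopologicalSpace G] [ChartedSpace E G] [Group G]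

omit [Group G] in
theorem eq_of_hasTangentMap_zero [IsManifold 𝓘(ℝ, E) 1 G] [PreconnectedSpace G] {f : G → ℝ}
    (hf : ∀ g, HasTangentMap f g (0 : E →L[ℝ] ℝ)) (g h : G) : f g = f h := by
  refine IsLocallyConstant.apply_eq_of_preconnectedSpace
    ((IsLocallyConstant.iff_eventually_eq f).2 fun g => ?_) g h
  set φ := extChartAt 𝓘(ℝ, E) g
  -- in a chart `f` is constant on a ball
  obtain ⟨r, hr, hball⟩ := Metric.mem_nhds_iff.1 (extChartAt_target_mem_nhds (I := 𝓘(ℝ, E)) g)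
  have hd : ∀ y ∈ Metric.ball (φ g) r, HasFDerivAt (fun z => f (φ.symm z)) (0 : E →L[ℝ] ℝ) y := by
    intro y hy
    have h1 : MDifferentiableAt 𝓘(ℝ, E) 𝓘(ℝ, E) φ.symm y := by
      have := mdifferentiableWithinAt_extChartAt_symm (I := 𝓘(ℝ, E)) (hball hy)
      rwa [ModelWithCorners.range_eq_univ, mdifferentiableWithinAt_univ] at this
    obtain ⟨A, hA⟩ : ∃ A : E →L[ℝ] E, HasTangentMap φ.symm y A := ⟨_, h1.hasTangentMap⟩
    have h2 := (hf (φ.symm y)).comp hA rfl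
    rw [ContinuousLinearMap.zero_comp] at h2
    exact hasTangentMap_iff_hasFDerivAt.1 h2
  have hconst : ∀ y ∈ Metric.ball (φ g) r, f (φ.symm y) = f (φ.symm (φ g)) := by
    intro y hy
    exact (convex_ball (φ g) r).is_const_of_fderivWithin_eq_zero (𝕜 := ℝ)
      (fun z hz => (hd z hz).differentiableAt.differentiableWithinAt)
      (fun z hz => by
        rw [fderivWithin_of_isOpen Metric.isOpen_ball hz, (hd z hz).fderiv]) hy
      (Metric.mem_ball_self hr)
  have hc : ContinuousAt φ g := continuousAt_extChartAt (I := 𝓘(ℝ, E)) g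
  filter_upwards [hc.eventually_mem (Metric.ball_mem_nhds (φ g) hr),
    extChartAt_source_mem_nhds (I := 𝓘(ℝ, E)) g] with x hx hxs
  have := hconst _ hx
  rwa [φ.left_inv hxs, φ.left_inv (mem_extChartAt_source (I := 𝓘(ℝ, E)) g)] at this

/-- The coadjoint action of `g` as a continuous linear map. -/
def coAdL (g : G) : Dual E →L[ℝ] Dual E := (ContinuousLinearMap.compL ℝ E E ℝ).flip (Ad g⁻¹)

theorem coAdL_apply (g : G) (L : Dual E) : coAdL g L = coAd g L := rfl

theorem coAd_apply (g : G) (L : Dual E) (X : E) : coAd g L X = L (Ad g⁻¹ X) := rfl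

variable [LieGroup 𝓘(ℝ, E) ∞ G]

theorem coAd_inv_coAd (g : G) (L : Dual E) : coAd g⁻¹ (coAd g L) = L := by
  rw [← coAd_mul, inv_mul_cancel, coAd_one]

theorem coAd_coAd_inv (g : G) (L : Dual E) : coAd g (coAd g⁻¹ L) = L := by
  rw [← coAd_mul, mul_inv_cancel, coAd_one]

/-- The infinitesimal coadjoint action: the derivative of `x ↦ Ad*_{x⁻¹} L` at the identity in the
direction `X` is the linear form `⟨L, [X, ·]⟩`. -/
theorem hasTangentMap_coAd_inv (L : Dual E) :
    HasTangentMap (fun x : G => coAd x⁻¹ L) 1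
      ((ContinuousLinearMap.compL ℝ E E ℝ L).comp (bracketL E G)) := by
  have h := (hasTangentMap_iff_hasFDerivAt.2
    (ContinuousLinearMap.compL ℝ E E ℝ L).hasFDerivAt).comp
    (hasTangentMap_Ad_one (E := E) (G := G)) rfl
  simpa only [coAd, inv_inv] using! h

variable [FiniteDimensional ℝ E]

variable (G) in
/-- The differential `dφ(L) ∈ 𝔤` of a function on `𝔤*`, with values in the model space. -/
def grad (φ : Dual E → ℝ) (L : Dual E) : E := dDual G φ L

omit [LieGroup 𝓘(ℝ, E) ∞ G] in
theorem apply_grad (φ : Dual E → ℝ) (L η : Dual E) : η (grad G φ L) = fderiv ℝ φ L η :=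
  pairing_dDual (G := G) φ L η

omit [FiniteDimensional ℝ E] in
theorem ext_dual {X Y : E} (h : ∀ η : Dual E, η X = η Y) : X = Y :=
  (SeparatingDual.eq_iff_forall_dual_eq (R := ℝ)).2 h

/-- The infinitesimal invariance of a Casimir function: test against the linear functions on
`𝔤*`. -/
theorem IsCasimir.apply_bracketL {H : Dual E → ℝ} (hH : IsCasimir G H) (L : Dual E) (Y : E) :
    L (bracketL E G (grad G H L) Y) = 0 := by
  have h := hH.2 (fun L => L Y) (ContinuousLinearMap.apply ℝ ℝ Y).contDiff L
  have hY : grad G (fun L : Dual E => L Y) L = Y := by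
    refine ext_dual fun η => ?_
    rw [apply_grad]
    have : HasFDerivAt (fun L : Dual E => L Y) (ContinuousLinearMap.apply ℝ ℝ Y) L :=
      (ContinuousLinearMap.apply ℝ ℝ Y).hasFDerivAt
    rw [this.fderiv]
    rfl
  rw [bracketL_apply]
  rw [← hY]
  exact h

/-- A Casimir function is invariant under the coadjoint action: its derivative along the action
vanishes, and `G` is connected. -/
theorem IsCasimir.coAd [PreconnectedSpace G] {H : Dual E → ℝ} (hH : IsCasimir G H) (g : G)
    (L : Dual E) : H (coAd g L) = H L := by
  have key : ∀ g : G, HasTangentMap (fun x : G => H (LieReduction.coAd x⁻¹ L)) g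
      (0 : E →L[ℝ] ℝ) := by
    intro g
    set L' := LieReduction.coAd g⁻¹ L with hL'
    have hHd : HasFDerivAt H (fderiv ℝ H L') L' :=
      (hH.1.differentiable (by simp) L').hasFDerivAt
    have h1 := (hasTangentMap_iff_hasFDerivAt.2 hHd).comp (hasTangentMap_coAd_inv (G := G) L')
      (by simp [coAd_one])
    have h0 : (fderiv ℝ H L').comp
        ((ContinuousLinearMap.compL ℝ E E ℝ L').comp (bracketL E G)) = 0 := by
      ext X
      have e1 := apply_grad (G := G) H L' (L'.comp (bracketL E G X))
      have e2 := hH.apply_bracketL L' X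
      rw [bracketL_skew, map_neg, neg_eq_zero] at e2
      simpa [e2] using! e1.symm
    rw [h0] at h1
    -- `Ad*_{x⁻¹} L = Ad*_{(g⁻¹ x)⁻¹} L'`, so the derivative at `g` reduces to that at
    -- the identity
    obtain ⟨A, hA⟩ := exists_hasTangentMap_mul_left (E := E) g⁻¹ g
    have h2 := h1.comp hA (inv_mul_cancel g)
    rw [ContinuousLinearMap.zero_comp] at h2
    convert h2 using 3 with x
    rw [hL', ← coAd_mul]
    congr 1
    group
  have := eq_of_hasTangentMap_zero key g⁻¹ 1
  simpa [coAd_one] using this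

/-- The differential of an invariant function is equivariant. -/
theorem IsCasimir.grad_coAd [PreconnectedSpace G] {H : Dual E → ℝ} (hH : IsCasimir G H) (g : G)
    (L : Dual E) : grad G H (LieReduction.coAd g L) = Ad g (grad G H L) := by
  refine ext_dual fun η => ?_
  have hd : ∀ L, HasFDerivAt H (fderiv ℝ H L) L := fun L =>
    (hH.1.differentiable (by simp) L).hasFDerivAt
  have h1 : HasFDerivAt (fun L => H (coAdL g L)) _ L :=
    (hd (coAdL g L)).comp L (coAdL (E := E) g).hasFDerivAt
  have h2 : (fun L => H (coAdL g L)) = H := funext fun L => hH.coAd g L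
  rw [h2] at h1
  have h3 := DFunLike.congr_fun ((hd L).unique h1) (LieReduction.coAd g⁻¹ η)
  rw [← apply_grad (G := G)] at h3
  rw [apply_grad]
  simp only [ContinuousLinearMap.comp_apply, coAdL_apply, coAd_coAd_inv] at h3
  rw [← h3, coAd_apply, inv_inv]

/-- `L` is fixed by the one-parameter subgroup of `dH(L)`: the curve `Ad*_{exp(-t dH(L))} L` has
derivative `⟨L, [dH(L), ·]⟩ = 0` at `t = 0`, hence zero derivative everywhere. -/
theorem IsCasimir.coAd_lieExp [T2Space G] {H : Dual E → ℝ} (hH : IsCasimir G H) (L : Dual E)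
    (t : ℝ) : LieReduction.coAd (lieExp (G := G) (t • grad G H L)) L = L := by
  set X : E := grad G H L with hX
  set γ : ℝ → G := fun t => lieExp (G := G) (t • X) with hγ
  have hγ0 : γ 0 = 1 := lieExp_zero_smul X
  have key : ∀ t, HasDerivAt (fun s => LieReduction.coAd (γ s)⁻¹ L) 0 t := by
    intro t
    have h1 := (hasTangentMap_coAd_inv (G := G) L).comp_velocity
      (hasVelocity_lieExp_zero (G := G) X) hγ0
    have h0 : (ContinuousLinearMap.compL ℝ E E ℝ L).comp (bracketL E G) X = 0 := by
      ext Y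
      exact hH.apply_bracketL L Y
    rw [h0] at h1
    have h2 := (hasTangentMap_iff_hasFDerivAt.2 (coAdL (E := E) (γ t)⁻¹).hasFDerivAt).comp_velocity
      h1 rfl
    rw [map_zero] at h2
    have h3 : HasVelocity (fun s => coAdL (γ t)⁻¹ (LieReduction.coAd (γ (s + -t))⁻¹ L)) t
        (0 : Dual E) :=
      HasVelocity.comp_add (γ := fun s => coAdL (γ t)⁻¹ (LieReduction.coAd (γ s)⁻¹ L))
        (by rwa [add_neg_cancel])
    rw [hasVelocity_iff_hasDerivAt] at h3
    refine h3.congr_of_eventuallyEq (Filter.Eventually.of_forall fun s => ?_)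
    change LieReduction.coAd (γ s)⁻¹ L =
      LieReduction.coAd (γ t)⁻¹ (LieReduction.coAd (γ (s + -t))⁻¹ L)
    rw [← coAd_mul, ← mul_inv_rev]
    congr 2
    have := lieExp_add_smul (G := G) X (s + -t) t
    rwa [neg_add_cancel_right] at this
  have h := is_const_of_deriv_eq_zero (fun t => (key t).differentiableAt)
    (fun t => (key t).deriv) t 0
  rw [hγ0, inv_one, coAd_one] at h
  have h' := coAd_coAd_inv (γ t) L
  rw [h] at h'
  exact h'

end Casimir

/-! ### The inverse function theorem for maps to a manifold -/

noncomputable section InverseFunction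

variable {F : Type*} [NormedAddCommGroup F] [NormedSpace ℝ F] [CompleteSpace F]
  {E : Type*} [NormedAddCommGroup E] [NormedSpace ℝ E] [CompleteSpace E]
  {M : Type*} [TopologicalSpace M] [ChartedSpace E M] [IsManifold 𝓘(ℝ, E) ∞ M]

/-- The inverse function theorem for a map from a vector space to a manifold. -/
theorem exists_local_section {f : F → M} {a : F} {f' : F →L[ℝ] E}
    (hf : ContMDiffAt 𝓘(ℝ, F) 𝓘(ℝ, E) ∞ f a) (hf' : HasTangentMap f a f')
    (hinj : Function.Injective f') (hsurj : Function.Surjective f') :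
    ∃ σ : M → F, ContMDiffAt 𝓘(ℝ, E) 𝓘(ℝ, F) ∞ σ (f a) ∧ σ (f a) = a ∧
      ∀ᶠ x in 𝓝 (f a), f (σ x) = x := by
  have : IsManifold 𝓘(ℝ, E) 1 M := IsManifold.of_le (n := ∞) (by simp)
  set φ := extChartAt 𝓘(ℝ, E) (f a) with hφ
  set e : F ≃L[ℝ] E := ContinuousLinearEquiv.ofBijective f' (LinearMap.ker_eq_bot.2 hinj)
    (LinearMap.range_eq_top.2 hsurj) with he
  have hc : ContDiffAt ℝ ∞ (fun z => φ (f z)) a :=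
    contMDiffAt_iff_contDiffAt.1 (contMDiffAt_extChartAt.comp a hf)
  have hd : HasFDerivAt (fun z => φ (f z)) (e : F →L[ℝ] E) a := by
    have := (hasTangentMap_extChartAt (f a)).comp hf' rfl
    rw [ContinuousLinearMap.id_comp] at this
    rw [he, ContinuousLinearEquiv.coe_ofBijective]
    exact hasTangentMap_iff_hasFDerivAt.1 this
  set τ := hc.localInverse hd (by simp) with hτ
  have hτa : τ (φ (f a)) = a := hc.localInverse_apply_image hd (by simp)
  have hτc : ContDiffAt ℝ ∞ τ (φ (f a)) := hc.to_localInverse hd (by simp)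
  have hσ : ContMDiffAt 𝓘(ℝ, E) 𝓘(ℝ, F) ∞ (fun x => τ (φ x)) (f a) :=
    ContMDiffAt.comp (I' := 𝓘(ℝ, E)) (g := τ) (f a) hτc.contMDiffAt contMDiffAt_extChartAt
  refine ⟨fun x => τ (φ x), hσ, hτa, ?_⟩
  have h1 : ∀ᶠ x in 𝓝 (f a), φ (f (τ (φ x))) = φ x :=
    (continuousAt_extChartAt (I := 𝓘(ℝ, E)) (f a)).eventually
      (hc.hasStrictFDerivAt' hd (by simp)).eventually_right_inverse
  have h2 : ∀ᶠ x in 𝓝 (f a), f (τ (φ x)) ∈ φ.source := by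
    have hcont : ContinuousAt (fun x => f (τ (φ x))) (f a) :=
      ContinuousAt.comp (g := f) (by
        rw [hτa]; exact hf.continuousAt) hσ.continuousAt
    refine hcont.eventually_mem ?_
    rw [hτa]
    exact extChartAt_source_mem_nhds (I := 𝓘(ℝ, E)) (f a)
  filter_upwards [h1, h2, extChartAt_source_mem_nhds (I := 𝓘(ℝ, E)) (f a)] with x hx1 hx2 hx3
  exact φ.injOn hx2 hx3 hx1

end InverseFunction

/-! ### Products and inverses near the identity -/

noncomputable section GroupDerivative

variable {E : Type*} [NormedAddCommGroup E] [NormedSpace ℝ E]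
  {G : Type*} [TopologicalSpace G] [ChartedSpace E G] [Group G] [LieGroup 𝓘(ℝ, E) ∞ G]
  {F : Type*} [NormedAddCommGroup F] [NormedSpace ℝ F]
  {N : Type*} [TopologicalSpace N] [ChartedSpace F N]

/-- At points where both factors are the identity, the tangent map of a product is the sum of the
tangent maps. -/
theorem HasTangentMap.mul_of_eq_one {u w : N → G} {x : N} {A B : F →L[ℝ] E}
    (hu : HasTangentMap u x A) (hw : HasTangentMap w x B) (hux : u x = 1) (hwx : w x = 1) :
    HasTangentMap (fun y => u y * w y) x (A + B) := by
  have hφu : HasTangentMap (fun y => chartOne E G (u y)) x A := by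
    have := (hasTangentMap_extChartAt (1 : G)).comp hu hux
    rwa [ContinuousLinearMap.id_comp] at this
  have hφw : HasTangentMap (fun y => chartOne E G (w y)) x B := by
    have := (hasTangentMap_extChartAt (1 : G)).comp hw hwx
    rwa [ContinuousLinearMap.id_comp] at this
  have hpair : HasTangentMap (fun y => (chartOne E G (u y), chartOne E G (w y))) x (A.prod B) :=
    ⟨(HasMFDerivAt.prodMk hφu hφw).1, (HasMFDerivAt.prodMk hφu hφw).2⟩
  have hm : HasTangentMap (chartMul E G) (origin E G, origin E G)
      (fderiv ℝ (chartMul E G) (origin E G, origin E G)) :=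
    hasTangentMap_iff_hasFDerivAt.2
      (eventually_hasFDerivAt_chartMul (E := E) (G := G)).self_of_nhds
  have h1 : chartMul E G (origin E G, origin E G) = origin E G :=
    chartMul_origin_left (mem_extChartAt_target (I := 𝓘(ℝ, E)) (1 : G))
  have h2 := (hasTangentMap_extChartAt_symm (1 : G)).comp
    (hm.comp hpair (by rw [hux, hwx])) (by rw [hux, hwx, h1])
  have h3 : (ContinuousLinearMap.id ℝ E).comp
      ((fderiv ℝ (chartMul E G) (origin E G, origin E G)).comp (A.prod B)) = A + B := by
    ext v
    exact fderiv_chartMul_origin (A v) (B v)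
  rw [h3] at h2
  refine h2.congr ?_
  have hs : (chartOne E G).source ∈ 𝓝 (1 : G) := extChartAt_source_mem_nhds (I := 𝓘(ℝ, E)) (1 : G)
  have hmul : ContinuousAt (fun y => u y * w y) x := by
    have : ContinuousMul G := continuousMul_of_contMDiffMul 𝓘(ℝ, E) ∞
    exact hu.continuousAt.mul hw.continuousAt
  filter_upwards [hu.continuousAt.eventually_mem (by rwa [hux]),
    hw.continuousAt.eventually_mem (by rwa [hwx]),
    hmul.eventually_mem (by rwa [hux, hwx, one_mul])] with y hy1 hy2 hy3
  simp only [chartMul]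
  rw [(chartOne E G).left_inv hy1, (chartOne E G).left_inv hy2, (chartOne E G).left_inv hy3]

theorem hasTangentMap_inv_one :
    HasTangentMap (fun x : G => x⁻¹) 1 (-ContinuousLinearMap.id ℝ E) := by
  obtain ⟨A, hA⟩ := (contMDiff_inv 𝓘(ℝ, E) (n := ∞) (G := G) 1).exists_hasTangentMap
  have h := (hasTangentMap_id (1 : G)).mul_of_eq_one hA rfl inv_one
  simp only [mul_inv_cancel] at h
  have h0 := h.unique (hasTangentMap_const (1 : G) (1 : G))
  rwa [← eq_neg_of_add_eq_zero_right h0]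

theorem HasTangentMap.inv_of_eq_one {u : N → G} {x : N} {A : F →L[ℝ] E}
    (hu : HasTangentMap u x A) (hux : u x = 1) : HasTangentMap (fun y => (u y)⁻¹) x (-A) := by
  have h := hasTangentMap_inv_one.comp hu hux
  rwa [ContinuousLinearMap.neg_comp, ContinuousLinearMap.id_comp] at h

end GroupDerivative

/-! ### The splitting of the Lie algebra -/

noncomputable section Factor

variable {E : Type*} [NormedAddCommGroup E] [NormedSpace ℝ E] [FiniteDimensional ℝ E]
  {G : Type*} [TopologicalSpace G] [ChartedSpace E G] [Group G] [LieGroup 𝓘(ℝ, E) ∞ G]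
  {gp gm : LieSubalgebra ℝ (Alg E G)} (hc : IsCompl gp.toSubmodule gm.toSubmodule)

/-- The projection `P₋` of `𝔤 = 𝔤₊ ⊕ 𝔤₋` onto `𝔤₋`, on the model space. -/
def projMinus : E →L[ℝ] E :=
  LinearMap.toContinuousLinearMap (E := E) (Submodule.projection (E := E) _ _ hc.symm)

theorem projMinus_eq {a b X : E} (ha : (a : Alg E G) ∈ gp) (hb : (b : Alg E G) ∈ gm)
    (h : X = a + b) : projMinus hc X = b := by
  subst h
  rw [map_add]
  have h1 : projMinus hc a = 0 :=
    (Submodule.projection_apply_eq_zero_iff (E := Alg E G) hc.symm).2 ha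
  have h2 : projMinus hc b = b :=
    Submodule.projection_apply_of_mem_left (E := Alg E G) hc.symm hb
  rw [h1, h2, zero_add]

include hc in
theorem exists_add_eq (X : E) :
    ∃ a b : E, (a : Alg E G) ∈ gp ∧ (b : Alg E G) ∈ gm ∧ a + b = X := by
  have key : ∀ Y : Alg E G, ∃ a b : E, (a : Alg E G) ∈ gp ∧ (b : Alg E G) ∈ gm ∧ a + b = Y := by
    intro Y
    obtain ⟨a, b, ha, hb, h⟩ := Submodule.codisjoint_iff_exists_add_eq.1 hc.codisjoint Y
    exact ⟨a, b, ha, hb, h⟩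
  exact key X

include hc in
theorem eq_zero_of_mem_of_mem {X : E} (h : (X : Alg E G) ∈ gp) (h' : (X : Alg E G) ∈ gm) :
    X = 0 :=
  Submodule.disjoint_def.1 hc.disjoint X h h'

end Factor

/-! ### The factorisation problem -/

noncomputable section FactorAlgebra

variable {G Gp Gm : Type*} [Group G] [Group Gp] [Group Gm] {ιp : Gp →* G} {ιm : Gm →* G}

theorem factor_spec {g : G} (hg : g ∈ factorSet ιp ιm) :
    g = ιp (factor ιp ιm g).1 * (ιm (factor ιp ιm g).2)⁻¹ := by
  have h : ∃ h : Gp × Gm, g = ιp h.1 * (ιm h.2)⁻¹ := by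
    obtain ⟨a, b, h⟩ := hg
    exact ⟨(a, b), h⟩
  exact Classical.epsilon_spec h

theorem mul_mem_factorSet {g : G} (hg : g ∈ factorSet ιp ιm) (a : Gp) (b : Gm) :
    ιp a * g * (ιm b)⁻¹ ∈ factorSet ιp ιm := by
  obtain ⟨a', b', rfl⟩ := hg
  exact ⟨a * a', b * b', by simp [mul_assoc]⟩

theorem mul_mem_factorSet_iff {g : G} (a : Gp) (b : Gm) :
    ιp a * g * (ιm b)⁻¹ ∈ factorSet ιp ιm ↔ g ∈ factorSet ιp ιm := by
  refine ⟨fun h => ?_, fun h => mul_mem_factorSet h a b⟩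
  have := mul_mem_factorSet h a⁻¹ b⁻¹
  simpa [mul_assoc] using this

theorem one_mem_factorSet : (1 : G) ∈ factorSet ιp ιm := ⟨1, 1, by simp⟩

variable (huniq : ∀ (a a' : Gp) (b b' : Gm),
  ιp a * (ιm b)⁻¹ = ιp a' * (ιm b')⁻¹ → a = a' ∧ b = b')

include huniq

theorem factor_eq {g : G} {a : Gp} {b : Gm} (h : g = ιp a * (ιm b)⁻¹) :
    factor ιp ιm g = (a, b) := by
  have h2 := huniq _ _ _ _ ((factor_spec ⟨a, b, h⟩).symm.trans h)
  exact Prod.ext h2.1 h2.2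

theorem factor_one : factor ιp ιm 1 = (1, 1) := factor_eq huniq (by simp)

/-- The factorisation is equivariant under `G_R`. -/
theorem factor_mul {g : G} (hg : g ∈ factorSet ιp ιm) (a : Gp) (b : Gm) :
    factor ιp ιm (ιp a * g * (ιm b)⁻¹) = (a * (factor ιp ιm g).1, b * (factor ιp ιm g).2) := by
  refine factor_eq huniq ?_
  conv_lhs => rw [factor_spec hg]
  simp [mul_assoc]

end FactorAlgebra

noncomputable section FactorSmooth

variable {E : Type*} [NormedAddCommGroup E] [NormedSpace ℝ E] [FiniteDimensional ℝ E]
  {G : Type*} [TopologicalSpace G] [ChartedSpace E G] [Group G] [LieGroup 𝓘(ℝ, E) ∞ G]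
  {F : Type*} [NormedAddCommGroup F] [NormedSpace ℝ F]
  {K : Type*} [TopologicalSpace K] [ChartedSpace F K] [Group K]

theorem IsLieSubgroup.exists_hasTangentMap {ι : K →* G} {k : LieSubalgebra ℝ (Alg E G)}
    (h : IsLieSubgroup (F := F) ι k) :
    ∃ D : F →L[ℝ] E, HasTangentMap ι 1 D ∧ Function.Injective D ∧
      Set.range D = (k : Set (Alg E G)) :=
  ⟨_, (h.smooth.mdifferentiable (by simp) 1).hasTangentMap, h.immersive, h.range_eq⟩

variable {Ep : Type*} [NormedAddCommGroup Ep] [NormedSpace ℝ Ep] [FiniteDimensional ℝ Ep]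
  {Gp : Type*} [TopologicalSpace Gp] [ChartedSpace Ep Gp] [Group Gp] [LieGroup 𝓘(ℝ, Ep) ∞ Gp]
  {Em : Type*} [NormedAddCommGroup Em] [NormedSpace ℝ Em] [FiniteDimensional ℝ Em]
  {Gm : Type*} [TopologicalSpace Gm] [ChartedSpace Em Gm] [Group Gm] [LieGroup 𝓘(ℝ, Em) ∞ Gm]
  {gp gm : LieSubalgebra ℝ (Alg E G)} (hc : IsCompl gp.toSubmodule gm.toSubmodule)
  {ιp : Gp →* G} {ιm : Gm →* G}
  (hp : IsLieSubgroup (F := Ep) ιp gp) (hm : IsLieSubgroup (F := Em) ιm gm)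

include hc hp hm

/-- Near the identity the factorisation problem has a smooth solution, by the inverse function
theorem: the tangent map of `(a, b) ↦ a b⁻¹` at the identity is `(X, Y) ↦ X - Y`, and
`𝔤 = 𝔤₊ ⊕ 𝔤₋`. -/
theorem exists_local_factor :
    ∃ (σp : G → Gp) (σm : G → Gm), ContMDiffAt 𝓘(ℝ, E) 𝓘(ℝ, Ep) ∞ σp 1 ∧
      ContMDiffAt 𝓘(ℝ, E) 𝓘(ℝ, Em) ∞ σm 1 ∧
      ∀ᶠ x in 𝓝 (1 : G), x = ιp (σp x) * (ιm (σm x))⁻¹ := by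
  obtain ⟨Dp, hDp, hDpi, hDpr⟩ := hp.exists_hasTangentMap
  obtain ⟨Dm, hDm, hDmi, hDmr⟩ := hm.exists_hasTangentMap
  set o : Ep × Em := (origin Ep Gp, origin Em Gm) with ho
  set up : Ep × Em → G := fun z => ιp ((chartOne Ep Gp).symm z.1) with hup
  set um : Ep × Em → G := fun z => ιm ((chartOne Em Gm).symm z.2) with hum
  have hpo : up o = 1 := by simp only [hup, ho, chartOne_symm_origin, map_one]
  have hmo : um o = 1 := by simp only [hum, ho, chartOne_symm_origin, map_one]
  have hups : ContMDiffAt 𝓘(ℝ, Ep × Em) 𝓘(ℝ, E) ∞ up o :=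
    hp.smooth.contMDiffAt.comp o (ContMDiffAt.comp (I' := 𝓘(ℝ, Ep)) o contMDiffAt_chartOne_symm
      contDiffAt_fst.contMDiffAt)
  have hums : ContMDiffAt 𝓘(ℝ, Ep × Em) 𝓘(ℝ, E) ∞ um o :=
    hm.smooth.contMDiffAt.comp o (ContMDiffAt.comp (I' := 𝓘(ℝ, Em)) o contMDiffAt_chartOne_symm
      contDiffAt_snd.contMDiffAt)
  have hupd : HasTangentMap up o (Dp.comp (ContinuousLinearMap.fst ℝ Ep Em)) := by
    have h := (hDp.comp (hasTangentMap_extChartAt_symm (1 : Gp)) chartOne_symm_origin).comp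
      (hasTangentMap_iff_hasFDerivAt.2 (hasFDerivAt_fst (𝕜 := ℝ) (p := o))) rfl
    rwa [ContinuousLinearMap.comp_id] at h
  have humd : HasTangentMap um o (Dm.comp (ContinuousLinearMap.snd ℝ Ep Em)) := by
    have h := (hDm.comp (hasTangentMap_extChartAt_symm (1 : Gm)) chartOne_symm_origin).comp
      (hasTangentMap_iff_hasFDerivAt.2 (hasFDerivAt_snd (𝕜 := ℝ) (p := o))) rfl
    rwa [ContinuousLinearMap.comp_id] at h
  set f : Ep × Em → G := fun z => up z * (um z)⁻¹ with hf
  have hfo : f o = 1 := by simp only [hf, hpo, hmo, inv_one, mul_one]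
  have hfs : ContMDiffAt 𝓘(ℝ, Ep × Em) 𝓘(ℝ, E) ∞ f o := hups.mul hums.inv
  have hfd := hupd.mul_of_eq_one (humd.inv_of_eq_one hmo) hpo (by rw [hmo, inv_one])
  have hmemp : ∀ u, (Dp u : Alg E G) ∈ gp := fun u =>
    (Set.ext_iff.1 hDpr (Dp u)).1 ⟨u, rfl⟩
  have hmemm : ∀ u, (Dm u : Alg E G) ∈ gm := fun u =>
    (Set.ext_iff.1 hDmr (Dm u)).1 ⟨u, rfl⟩
  obtain ⟨σ, hσs, hσo, hσ⟩ := exists_local_section hfs hfd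
    (by
      rw [injective_iff_map_eq_zero]
      rintro ⟨u, v⟩ huv
      have huv' : Dp u = Dm v := by
        have : Dp u + -Dm v = 0 := huv
        exact add_neg_eq_zero.1 this
      have h0 : Dp u = 0 := eq_zero_of_mem_of_mem hc (hmemp u) (huv' ▸ hmemm v)
      have h0' : Dm v = 0 := huv' ▸ h0
      rw [hDpi (h0.trans (map_zero Dp).symm), hDmi (h0'.trans (map_zero Dm).symm)]
      rfl)
    (by
      intro X
      obtain ⟨a, b, ha, hb, h⟩ := exists_add_eq hc X
      obtain ⟨u, hu⟩ := (Set.ext_iff.1 hDpr a).2 ha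
      obtain ⟨v, hv⟩ := (Set.ext_iff.1 hDmr b).2 hb
      refine ⟨(u, -v), ?_⟩
      change Dp u + -Dm (-v) = X
      rw [map_neg, neg_neg, hu, hv, h])
  rw [hfo] at hσs hσo hσ
  refine ⟨fun x => (chartOne Ep Gp).symm (σ x).1, fun x => (chartOne Em Gm).symm (σ x).2, ?_, ?_,
    ?_⟩
  · refine ContMDiffAt.comp (I' := 𝓘(ℝ, Ep)) (g := (chartOne Ep Gp).symm) 1 ?_
      (ContMDiffAt.comp (I' := 𝓘(ℝ, Ep × Em)) (g := Prod.fst) 1 contDiffAt_fst.contMDiffAt hσs)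
    rw [hσo]
    exact contMDiffAt_chartOne_symm
  · refine ContMDiffAt.comp (I' := 𝓘(ℝ, Em)) (g := (chartOne Em Gm).symm) 1 ?_
      (ContMDiffAt.comp (I' := 𝓘(ℝ, Ep × Em)) (g := Prod.snd) 1 contDiffAt_snd.contMDiffAt hσs)
    rw [hσo]
    exact contMDiffAt_chartOne_symm
  · filter_upwards [hσ] with x hx
    exact hx.symm

/-- Translate the local solution at the identity by the action of `G_R` on `G`. -/
theorem factorSet_mem_nhds {g : G} (hg : g ∈ factorSet ιp ιm) : factorSet ιp ιm ∈ 𝓝 g := by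
  obtain ⟨σp, σm, -, -, h⟩ := exists_local_factor hc hp hm
  have h1 : factorSet ιp ιm ∈ 𝓝 (1 : G) := by
    filter_upwards [h] with x hx
    exact ⟨_, _, hx⟩
  have hcont : Continuous (fun x : G => (ιp (factor ιp ιm g).1)⁻¹ * x * ιm (factor ιp ιm g).2) :=
    ((contMDiff_const.mul contMDiff_id).mul contMDiff_const
      (I := 𝓘(ℝ, E)) (I' := 𝓘(ℝ, E)) (n := ∞)).continuous
  have hg1 : (ιp (factor ιp ιm g).1)⁻¹ * g * ιm (factor ιp ιm g).2 = 1 := by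
    have h := factor_spec hg
    generalize factor ιp ιm g = c at h
    rw [h]
    group
  filter_upwards [hcont.continuousAt.eventually_mem (by rw [hg1]; exact h1)] with x hx
  have := mul_mem_factorSet hx (factor ιp ιm g).1 (factor ιp ιm g).2
  simpa [mul_assoc] using this

theorem isOpen_factorSet : IsOpen (factorSet ιp ιm) :=
  isOpen_iff_mem_nhds.2 fun _ hg => factorSet_mem_nhds hc hp hm hg

variable (huniq : ∀ (a a' : Gp) (b b' : Gm),
  ιp a * (ιm b)⁻¹ = ιp a' * (ιm b')⁻¹ → a = a' ∧ b = b')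

include huniq

theorem contMDiffAt_factor_one :
    ContMDiffAt 𝓘(ℝ, E) 𝓘(ℝ, Ep) ∞ (fun x => (factor ιp ιm x).1) 1 ∧
      ContMDiffAt 𝓘(ℝ, E) 𝓘(ℝ, Em) ∞ (fun x => (factor ιp ιm x).2) 1 := by
  obtain ⟨σp, σm, hσp, hσm, h⟩ := exists_local_factor hc hp hm
  have h' : ∀ᶠ x in 𝓝 (1 : G), factor ιp ιm x = (σp x, σm x) := by
    filter_upwards [h] with x hx
    exact factor_eq huniq hx
  exact ⟨hσp.congr_of_eventuallyEq (h'.mono fun x hx => congrArg Prod.fst hx),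
    hσm.congr_of_eventuallyEq (h'.mono fun x hx => congrArg Prod.snd hx)⟩

theorem contMDiffAt_factor {g : G} (hg : g ∈ factorSet ιp ιm) :
    ContMDiffAt 𝓘(ℝ, E) 𝓘(ℝ, Ep) ∞ (fun x => (factor ιp ιm x).1) g ∧
      ContMDiffAt 𝓘(ℝ, E) 𝓘(ℝ, Em) ∞ (fun x => (factor ιp ιm x).2) g := by
  obtain ⟨h1, h2⟩ := contMDiffAt_factor_one hc hp hm huniq
  set a := (factor ιp ιm g).1 with ha
  set b := (factor ιp ιm g).2 with hb
  have hg1 : (ιp a)⁻¹ * g * ιm b = 1 := by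
    have h := factor_spec hg
    rw [← ha, ← hb] at h
    rw [h]
    group
  have htr : ContMDiff 𝓘(ℝ, E) 𝓘(ℝ, E) ∞ (fun x : G => (ιp a)⁻¹ * x * ιm b) :=
    (contMDiff_const.mul contMDiff_id).mul contMDiff_const
  have hev : ∀ᶠ x in 𝓝 g, factor ιp ιm x =
      (a * (factor ιp ιm ((ιp a)⁻¹ * x * ιm b)).1, b * (factor ιp ιm ((ιp a)⁻¹ * x * ιm b)).2) := by
    filter_upwards [factorSet_mem_nhds hc hp hm hg] with x hx
    have := factor_mul huniq hx a⁻¹ b⁻¹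
    rw [map_inv, map_inv, inv_inv] at this
    rw [this]
    simp
  rw [← hg1] at h1 h2
  exact ⟨(contMDiffAt_const.mul (h1.comp g htr.contMDiffAt)).congr_of_eventuallyEq
      (hev.mono fun x hx => congrArg Prod.fst hx),
    (contMDiffAt_const.mul (h2.comp g htr.contMDiffAt)).congr_of_eventuallyEq
      (hev.mono fun x hx => congrArg Prod.snd hx)⟩

/-- The derivative of `x ↦ x₋` at the identity, where `x = x₊ x₋⁻¹`, is `-P₋`: differentiating the
factorisation gives `X = X₊' - X₋'` with `X₊' ∈ 𝔤₊` and `X₋' ∈ 𝔤₋`. -/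
theorem hasTangentMap_factor_snd :
    HasTangentMap (fun x => ιm (factor ιp ιm x).2) 1 (-projMinus hc) := by
  obtain ⟨Dp, hDp, -, hDpr⟩ := hp.exists_hasTangentMap
  obtain ⟨Dm, hDm, -, hDmr⟩ := hm.exists_hasTangentMap
  obtain ⟨h1, h2⟩ := contMDiffAt_factor_one hc hp hm huniq
  obtain ⟨Sp, hSp⟩ := h1.exists_hasTangentMap
  obtain ⟨Sm, hSm⟩ := h2.exists_hasTangentMap
  have f1 : (factor ιp ιm 1).1 = 1 := by rw [factor_one huniq]
  have f2 : (factor ιp ιm 1).2 = 1 := by rw [factor_one huniq]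
  have hA := hDp.comp hSp f1
  have hB := hDm.comp hSm f2
  have hsum := hA.mul_of_eq_one (hB.inv_of_eq_one (by rw [f2, map_one])) (by rw [f1, map_one])
    (by rw [f2, map_one, inv_one])
  have hid := (hasTangentMap_id (1 : G)).unique (hsum.congr (by
    filter_upwards [factorSet_mem_nhds hc hp hm one_mem_factorSet] with x hx
    exact factor_spec hx))
  have hproj : Dm.comp Sm = -projMinus hc := by
    ext X
    have hX := DFunLike.congr_fun hid X
    have hmem : ((-Dm (Sm X) : E) : Alg E G) ∈ gm :=
      neg_mem (S := LieSubalgebra ℝ (Alg E G)) ((Set.ext_iff.1 hDmr (Dm (Sm X))).1 ⟨Sm X, rfl⟩)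
    have : projMinus hc X = _ := projMinus_eq hc
      ((Set.ext_iff.1 hDpr (Dp (Sp X))).1 ⟨Sp X, rfl⟩) hmem hX
    change Dm (Sm X) = -projMinus hc X
    rw [this, neg_neg]
  rwa [hproj] at hB

end FactorSmooth

/-! ### The brackets of `𝔤_R` and of `T*G` -/

noncomputable section Bracket

variable {E : Type*} [NormedAddCommGroup E] [NormedSpace ℝ E] [FiniteDimensional ℝ E]
  {G : Type*} [TopologicalSpace G] [ChartedSpace E G] [Group G] [LieGroup 𝓘(ℝ, E) ∞ G]
  {gp gm : LieSubalgebra ℝ (Alg E G)} (hc : IsCompl gp.toSubmodule gm.toSubmodule)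

/-- `R = I - 2 P₋`. -/
theorem rMatrix_eq (X : Alg E G) :
    rMatrix hc X = X - (2 : ℝ) • Submodule.projection _ _ hc.symm X := by
  have h := Submodule.projection_add_projection_eq_self hc X
  rw [rMatrix, two_smul]
  nth_rewrite 3 [← h]
  abel

/-- `½ (R + I) = P₊`, written as `I - P₋`. -/
theorem half_smul_rMatrix_add (X : Alg E G) :
    (1 / 2 : ℝ) • (rMatrix hc X + X) = X - Submodule.projection _ _ hc.symm X := by
  rw [rMatrix_eq]
  module

/-- `½ (R - I) = -P₋`. -/
theorem half_smul_rMatrix_sub (X : Alg E G) :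
    (1 / 2 : ℝ) • (rMatrix hc X - X) = -Submodule.projection _ _ hc.symm X := by
  rw [rMatrix_eq]
  module

/-- `[X, Y]_R = [X, Y] - [X₋, Y] - [X, Y₋]`, paired with a linear form. -/
theorem apply_rBracket (η : Dual E) (X Y : E) :
    η (rBracket hc X Y : E) = η (bracketL E G X Y) - η (bracketL E G (projMinus hc X) Y) -
      η (bracketL E G X (projMinus hc Y)) := by
  have h : ∀ U V : E, rMatrix hc X = U → rMatrix hc Y = V →
      (rBracket hc X Y : E) = (1 / 2 : ℝ) • (bracketL E G U Y + bracketL E G X V) := by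
    rintro U V rfl rfl
    exact Eq.trans (b := (1 / 2 : ℝ) • (bracketE (E := E) G (rMatrix hc X) Y +
        bracketE (E := E) G X (rMatrix hc Y)))
      rfl (congrArg _ (congrArg₂ _ (bracketL_apply (E := E) _ _).symm
        (bracketL_apply (E := E) _ _).symm))
  have hR : ∀ Z : E, rMatrix hc Z = (Z - (2 : ℝ) • projMinus hc Z : E) := rMatrix_eq hc
  rw [h _ _ (hR X) (hR Y)]
  simp only [map_sub, map_add, map_smul, sub_apply, smul_apply, smul_eq_mul]
  ring

theorem apply_coad (X : E) (L : Dual E) (Y : E) : coad (G := G) X L Y = -L (bracketL E G X Y) := by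
  rw [bracketL_apply]
  rfl

omit [LieGroup 𝓘(ℝ, E) ∞ G] in
/-- The differential of `φ ∘ Ad*_g`. -/
theorem grad_comp_coAd {φ : Dual E → ℝ} (hφ : Differentiable ℝ φ) (g : G) (L : Dual E) :
    grad G (fun L => φ (coAd g L)) L = Ad g⁻¹ (grad G φ (coAd g L)) := by
  refine ext_dual fun η => ?_
  have h : HasFDerivAt (fun L => φ (coAdL g L)) _ L :=
    (hφ (coAdL g L)).hasFDerivAt.comp L (coAdL (E := E) g).hasFDerivAt
  rw [apply_grad]
  refine (DFunLike.congr_fun h.fderiv η).trans ?_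
  rw [← coAd_apply, apply_grad]
  rfl

omit [FiniteDimensional ℝ E] in
/-- The left invariant derivative at `(g, L)` is the derivative of `x ↦ f (g x, L)` at the
identity. -/
theorem dGroup_eq {f : Cotangent E G → ℝ} {p : Cotangent E G} {A : E →L[ℝ] ℝ}
    (hf : MDifferentiableAt 𝓘(ℝ, E) 𝓘(ℝ, ℝ) (fun g : G => f (g, p.2)) p.1)
    (hA : HasTangentMap (fun x : G => f (p.1 * x, p.2)) 1 A) (X : E) : dGroup f p X = A X := by
  obtain ⟨B, hB⟩ := exists_hasTangentMap_mul_left (E := E) p.1 (1 : G)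
  have h := hf.hasTangentMap.comp hB (mul_one p.1)
  rw [hA.unique h]
  change _ = (mfderiv 𝓘(ℝ, E) 𝓘(ℝ, ℝ) (fun g : G => f (g, p.2)) p.1 : E →L[ℝ] ℝ) (B X)
  rw [← hB.leftField]
  rfl

end Bracket

/-! ### The reduction map -/

noncomputable section Reduction

variable {E : Type*} [NormedAddCommGroup E] [NormedSpace ℝ E]
  {G : Type*} [TopologicalSpace G] [ChartedSpace E G] [Group G] [LieGroup 𝓘(ℝ, E) ∞ G]
  {Gp Gm : Type*} [Group Gp] [Group Gm] {ιp : Gp →* G} {ιm : Gm →* G}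

omit [TopologicalSpace G] [ChartedSpace E G] [LieGroup 𝓘(ℝ, E) ∞ G] in
theorem mem_factorDomain {p : Cotangent E G} :
    p ∈ factorDomain E ιp ιm ↔ p.1 ∈ factorSet ιp ιm := by
  simp [factorDomain]

omit [LieGroup 𝓘(ℝ, E) ∞ G] in
theorem act_mem_factorDomain_iff {h : Gp × Gm} {p : Cotangent E G} :
    act ιp ιm h p ∈ factorDomain E ιp ιm ↔ p ∈ factorDomain E ιp ιm := by
  rw [mem_factorDomain, mem_factorDomain]
  exact mul_mem_factorSet_iff h.1 h.2

theorem act_mul (h k : Gp × Gm) (p : Cotangent E G) :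
    act ιp ιm (h * k) p = act ιp ιm h (act ιp ιm k p) := by
  refine Prod.ext ?_ ?_
  · simp [act, mul_assoc]
  · simp [act, coAd_mul]

theorem act_one (p : Cotangent E G) : act ιp ιm 1 p = p := by
  refine Prod.ext ?_ ?_
  · simp [act]
  · simp [act, coAd_one]

omit [LieGroup 𝓘(ℝ, E) ∞ G] in
/-- Every orbit in the factorisable part of `T*G` meets the fibre over the identity, at the value
of the reduction map. -/
theorem act_factor_inv {p : Cotangent E G} (hp : p ∈ factorDomain E ιp ιm) :
    act ιp ιm (factor ιp ιm p.1)⁻¹ p = (1, redMap ιp ιm p) := by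
  have h := factor_spec (mem_factorDomain.1 hp)
  refine Prod.ext ?_ ?_
  · change ιp (factor ιp ιm p.1).1⁻¹ * p.1 * (ιm (factor ιp ιm p.1).2⁻¹)⁻¹ = 1
    generalize factor ιp ιm p.1 = c at h
    rw [h]
    simp
  · simp [act, redMap]

theorem act_factor_one {p : Cotangent E G} (hp : p ∈ factorDomain E ιp ιm) :
    act ιp ιm (factor ιp ιm p.1) (1, redMap ιp ιm p) = p := by
  rw [← act_factor_inv hp, ← act_mul, mul_inv_cancel, act_one]

omit [LieGroup 𝓘(ℝ, E) ∞ G] in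
theorem dFibre_comp_redMap [FiniteDimensional ℝ E] {φ : Dual E → ℝ} (hφ : ContDiff ℝ ∞ φ)
    (p : Cotangent E G) :
    (dFibre (fun q => φ (redMap ιp ιm q)) p : E) =
      Ad (ιm (factor ιp ιm p.1).2) (grad G φ (redMap ιp ιm p)) := by
  have h := grad_comp_coAd (hφ.differentiable (by simp)) (ιm (factor ιp ιm p.1).2)⁻¹ p.2
  rw [inv_inv] at h
  exact h

variable (huniq : ∀ (a a' : Gp) (b b' : Gm),
  ιp a * (ιm b)⁻¹ = ιp a' * (ιm b')⁻¹ → a = a' ∧ b = b')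

include huniq

theorem redMap_act (h : Gp × Gm) {p : Cotangent E G} (hp : p ∈ factorDomain E ιp ιm) :
    redMap ιp ιm (act ιp ιm h p) = redMap ιp ιm p := by
  have h1 := factor_mul huniq (mem_factorDomain.1 hp) h.1 h.2
  simp only [redMap, act]
  rw [h1, map_mul, mul_inv_rev, ← coAd_mul, inv_mul_cancel_right]

theorem redMap_one (L : Dual E) : redMap ιp ιm ((1 : G), L) = L := by
  simp [redMap, factor_one huniq, coAd_one]

theorem redMap_eq_iff {p q : Cotangent E G} (hp : p ∈ factorDomain E ιp ιm)
    (hq : q ∈ factorDomain E ιp ιm) :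
    redMap ιp ιm p = redMap ιp ιm q ↔ ∃ h : Gp × Gm, act ιp ιm h p = q := by
  constructor
  · intro h
    refine ⟨factor ιp ιm q.1 * (factor ιp ιm p.1)⁻¹, ?_⟩
    rw [act_mul, act_factor_inv hp, h, act_factor_one hq]
  · rintro ⟨h, rfl⟩
    exact (redMap_act huniq h hp).symm

end Reduction

/-! ### Smoothness of the reduction map and the quotient Poisson structure -/

noncomputable section ReductionSmooth

variable {E : Type*} [NormedAddCommGroup E] [NormedSpace ℝ E] [FiniteDimensional ℝ E]
  {G : Type*} [TopologicalSpace G] [ChartedSpace E G] [Group G] [LieGroup 𝓘(ℝ, E) ∞ G]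
  {Ep : Type*} [NormedAddCommGroup Ep] [NormedSpace ℝ Ep] [FiniteDimensional ℝ Ep]
  {Gp : Type*} [TopologicalSpace Gp] [ChartedSpace Ep Gp] [Group Gp] [LieGroup 𝓘(ℝ, Ep) ∞ Gp]
  {Em : Type*} [NormedAddCommGroup Em] [NormedSpace ℝ Em] [FiniteDimensional ℝ Em]
  {Gm : Type*} [TopologicalSpace Gm] [ChartedSpace Em Gm] [Group Gm] [LieGroup 𝓘(ℝ, Em) ∞ Gm]
  {gp gm : LieSubalgebra ℝ (Alg E G)} (hc : IsCompl gp.toSubmodule gm.toSubmodule)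
  {ιp : Gp →* G} {ιm : Gm →* G}
  (hp : IsLieSubgroup (F := Ep) ιp gp) (hm : IsLieSubgroup (F := Em) ιm gm)
  (huniq : ∀ (a a' : Gp) (b b' : Gm),
    ιp a * (ιm b)⁻¹ = ιp a' * (ιm b')⁻¹ → a = a' ∧ b = b')

include hc hp hm

theorem isOpen_factorDomain : IsOpen (factorDomain E ιp ιm) :=
  (isOpen_factorSet hc hp hm).prod isOpen_univ

include huniq

theorem contMDiffAt_redMap {p : Cotangent E G} (h : p ∈ factorDomain E ιp ιm) :
    ContMDiffAt (𝓘(ℝ, E).prod 𝓘(ℝ, Dual E)) 𝓘(ℝ, Dual E) ∞ (redMap ιp ιm) p := by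
  have h1 : ContMDiffAt (𝓘(ℝ, E).prod 𝓘(ℝ, Dual E)) 𝓘(ℝ, E →L[ℝ] E) ∞
      (fun q : Cotangent E G => Ad (E := E) (ιm (factor ιp ιm q.1).2)) p :=
    contMDiff_Ad.contMDiffAt.comp p (hm.smooth.contMDiffAt.comp p
      ((contMDiffAt_factor hc hp hm huniq (mem_factorDomain.1 h)).2.comp p contMDiffAt_fst))
  have h2 : ContMDiffAt (𝓘(ℝ, E).prod 𝓘(ℝ, Dual E)) 𝓘(ℝ, E →L[ℝ] ℝ) ∞
      (fun q : Cotangent E G => q.2) p := contMDiffAt_snd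
  have h3 := h2.clm_comp h1
  have e : (redMap ιp ιm : Cotangent E G → Dual E) =
      fun q => q.2.comp (Ad (ιm (factor ιp ιm q.1).2)) :=
    funext fun q => by simp only [redMap, coAd, inv_inv]
  rw [e]
  exact h3

/-- The derivative of the reduction map along `G` at `(1, L)`. -/
theorem hasTangentMap_redMap_one (L : Dual E) :
    HasTangentMap (fun x : G => redMap ιp ιm (x, L)) 1
      (-((ContinuousLinearMap.compL ℝ E E ℝ L).comp (bracketL E G)).comp (projMinus hc)) := by
  have h := (hasTangentMap_coAd_inv (G := G) L).comp (hasTangentMap_factor_snd hc hp hm huniq)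
    (by rw [factor_one huniq, map_one])
  rwa [ContinuousLinearMap.comp_neg] at h

/-- The derivative of the reduction map along `G` at `(g, L)`, in left trivialisation: the action
of `(g₊⁻¹, g₋⁻¹)` moves `(g x, L)` to `(g₋⁻¹ x g₋, s(g, L))`. -/
theorem hasTangentMap_redMap {p : Cotangent E G} (h : p ∈ factorDomain E ιp ιm) :
    HasTangentMap (fun x : G => redMap ιp ιm (p.1 * x, p.2)) 1
      (-(((ContinuousLinearMap.compL ℝ E E ℝ (redMap ιp ιm p)).comp (bracketL E G)).comp
        (projMinus hc)).comp (Ad (ιm (factor ιp ιm p.1).2)⁻¹)) := by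
  have h1 := (hasTangentMap_redMap_one hc hp hm huniq (redMap ιp ιm p)).comp
    (hasTangentMap_conj (E := E) (ιm (factor ιp ιm p.1).2)⁻¹) (by group)
  rw [ContinuousLinearMap.neg_comp] at h1
  refine h1.congr ?_
  have hcont : Continuous (fun x : G => p.1 * x) :=
    (contMDiff_mul_left (I := 𝓘(ℝ, E)) (n := ∞)).continuous
  have hopen := (isOpen_factorSet hc hp hm).mem_nhds (mem_factorDomain.1 h)
  filter_upwards [hcont.continuousAt.eventually_mem (x := (1 : G)) (by simpa using hopen)]
    with x hx
  have hx' : (p.1 * x, p.2) ∈ factorDomain E ιp ιm := mem_factorDomain.2 hx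
  rw [← redMap_act huniq (factor ιp ιm p.1)⁻¹ hx']
  congr 1
  refine Prod.ext ?_ ?_
  · have hs := factor_spec (mem_factorDomain.1 h)
    change ιp (factor ιp ιm p.1).1⁻¹ * (p.1 * x) * (ιm (factor ιp ιm p.1).2⁻¹)⁻¹ =
      (ιm (factor ιp ιm p.1).2)⁻¹ * x * ((ιm (factor ιp ιm p.1).2)⁻¹)⁻¹
    generalize factor ιp ιm p.1 = c at hs
    rw [hs]
    simp [mul_assoc]
  · simp [act, redMap]

theorem dGroup_comp_redMap {φ : Dual E → ℝ} (hφ : ContDiff ℝ ∞ φ) {p : Cotangent E G}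
    (h : p ∈ factorDomain E ιp ιm) (X : E) :
    dGroup (fun q => φ (redMap ιp ιm q)) p X =
      -redMap ιp ιm p (bracketL E G (projMinus hc (Ad (ιm (factor ιp ιm p.1).2)⁻¹ X))
        (grad G φ (redMap ιp ιm p))) := by
  have hφd : HasFDerivAt φ (fderiv ℝ φ (redMap ιp ιm p)) (redMap ιp ιm p) :=
    (hφ.differentiable (by simp) _).hasFDerivAt
  have h1 := (hasTangentMap_iff_hasFDerivAt.2 hφd).comp (hasTangentMap_redMap hc hp hm huniq h)
    (by rw [mul_one])
  have h2 : ContMDiffAt 𝓘(ℝ, E) 𝓘(ℝ, ℝ) ∞ (fun g : G => φ (redMap ιp ιm (g, p.2))) p.1 :=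
    hφ.contMDiff.contMDiffAt.comp p.1 ((contMDiffAt_redMap hc hp hm huniq h).comp p.1
      (contMDiffAt_id.prodMk contMDiffAt_const))
  rw [dGroup_eq (h2.mdifferentiableAt (by simp)) h1]
  simp only [ContinuousLinearMap.comp_apply, neg_apply, map_neg]
  rw [← apply_grad (G := G)]
  rfl

/-- The reduction map is Poisson. With `A`, `B` the differentials of `φ`, `ψ` at `s = s(p)`, the
fibre derivatives are `Ad_{g₋} A`, `Ad_{g₋} B`, the group derivatives are
`-⟨s, [P₋ Ad_{g₋}⁻¹ ·, A]⟩` and `-⟨s, [P₋ Ad_{g₋}⁻¹ ·, B]⟩`, and the three terms of the canonical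
bracket add up to `⟨s, [A, B]_R⟩`. -/
theorem cotangentBracket_comp_redMap {φ ψ : Dual E → ℝ} (hφ : ContDiff ℝ ∞ φ)
    (hψ : ContDiff ℝ ∞ ψ) {p : Cotangent E G} (h : p ∈ factorDomain E ιp ιm) :
    cotangentBracket (fun q => φ (redMap ιp ιm q)) (fun q => ψ (redMap ιp ιm q)) p =
      liePoisson (rBracket hc) φ ψ (redMap ιp ιm p) := by
  set g := ιm (factor ιp ιm p.1).2 with hg
  set A := grad G φ (redMap ιp ιm p) with hA
  set B := grad G ψ (redMap ιp ιm p) with hB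
  have e : ∀ X : E, Ad g⁻¹ (Ad g X) = X := fun X => DFunLike.congr_fun (Ad_inv_comp (E := E) g) X
  have h1 : cotangentBracket (fun q => φ (redMap ιp ιm q)) (fun q => ψ (redMap ιp ιm q)) p =
      dGroup (fun q => ψ (redMap ιp ιm q)) p (Ad (E := E) g A) -
        dGroup (fun q => φ (redMap ιp ιm q)) p (Ad (E := E) g B) +
        p.2 (bracketE G (Ad g A) (Ad g B)) := by
    have key : ∀ U V : E, (dFibre (fun q => φ (redMap ιp ιm q)) p : E) = U →
        (dFibre (fun q => ψ (redMap ιp ιm q)) p : E) = V →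
        cotangentBracket (fun q => φ (redMap ιp ιm q)) (fun q => ψ (redMap ιp ιm q)) p =
          dGroup (fun q => ψ (redMap ιp ιm q)) p U - dGroup (fun q => φ (redMap ιp ιm q)) p V +
          p.2 (bracketE G U V) := by
      rintro U V rfl rfl
      rfl
    exact key _ _ (dFibre_comp_redMap (E := E) hφ p) (dFibre_comp_redMap (E := E) hψ p)
  rw [h1, dGroup_comp_redMap hc hp hm huniq hψ h, dGroup_comp_redMap hc hp hm huniq hφ h,
    ← bracketL_apply, ← Ad_bracketL, ← hg, e, e, ← hA, ← hB]
  have h2 : p.2 (Ad g (bracketL E G A B)) = redMap ιp ιm p (bracketL E G A B) := by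
    simp only [redMap, coAd_apply, inv_inv]
    rw [← hg]
  have h3 : liePoisson (rBracket hc) φ ψ (redMap ιp ιm p) =
      redMap ιp ιm p (rBracket hc A B : E) := rfl
  rw [h2, h3, apply_rBracket, bracketL_skew (projMinus hc B) A, map_neg]
  ring

/-- Invariant smooth functions descend, uniquely: restrict to the fibre over the identity. -/
theorem existsUnique_comp_redMap {f : Cotangent E G → ℝ}
    (hf : ContMDiffOn (𝓘(ℝ, E).prod 𝓘(ℝ, Dual E)) 𝓘(ℝ, ℝ) ∞ f (factorDomain E ιp ιm))
    (hinv : ∀ (h : Gp × Gm), ∀ p ∈ factorDomain E ιp ιm, f (act ιp ιm h p) = f p) :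
    ∃! φ : Dual E → ℝ, ContDiff ℝ ∞ φ ∧
      ∀ p ∈ factorDomain E ιp ιm, f p = φ (redMap ιp ιm p) := by
  have hone : ∀ L : Dual E, ((1 : G), L) ∈ factorDomain E ιp ιm := fun L =>
    mem_factorDomain.2 one_mem_factorSet
  refine ⟨fun L => f (1, L), ⟨?_, fun p h => ?_⟩, fun φ hφ => funext fun L => ?_⟩
  · refine contMDiff_iff_contDiff.1 fun L => ?_
    exact (hf.contMDiffAt ((isOpen_factorDomain hc hp hm).mem_nhds (hone L))).comp L
      (contMDiffAt_const.prodMk contMDiffAt_id)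
  · rw [← hinv _ p h, act_factor_inv h]
  · rw [hφ.2 _ (hone L), redMap_one huniq]

end ReductionSmooth

/-! ### The free flow -/

noncomputable section FreeFlow

variable {E : Type*} [NormedAddCommGroup E] [NormedSpace ℝ E] [FiniteDimensional ℝ E]
  {G : Type*} [TopologicalSpace G] [ChartedSpace E G] [Group G] [LieGroup 𝓘(ℝ, E) ∞ G] [T2Space G]
  {H : Dual E → ℝ}

theorem freeFlow_zero (p : Cotangent E G) : freeFlow H 0 p = p :=
  Prod.ext ((congrArg (p.1 * ·) (lieExp_zero_smul (G := G) (grad G H p.2))).trans (mul_one p.1)) rfl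

theorem freeFlow_add (s t : ℝ) (p : Cotangent E G) :
    freeFlow H (s + t) p = freeFlow H t (freeFlow H s p) :=
  Prod.ext ((congrArg (p.1 * ·) (lieExp_add_smul (G := G) (grad G H p.2) s t)).trans
    (mul_assoc _ _ _).symm) rfl

/-- Along the free flow `L` is constant and `g` follows the left invariant field of `dH(L)`; the
remaining term `⟨L, [dH(L), ·]⟩` of the Hamiltonian vector field vanishes as `H` is a Casimir
function. -/
theorem hasDerivAt_comp_freeFlow (hH : IsCasimir G H) {f : Cotangent E G → ℝ}
    (hf : ContMDiff (𝓘(ℝ, E).prod 𝓘(ℝ, Dual E)) 𝓘(ℝ, ℝ) ∞ f) (p : Cotangent E G) (t : ℝ) :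
    HasDerivAt (fun τ => f (freeFlow H τ p)) (cotangentBracket (lift H) f (freeFlow H t p)) t := by
  set X : E := grad G H p.2 with hX
  have hfp : ContMDiff 𝓘(ℝ, E) 𝓘(ℝ, ℝ) ∞ (fun g : G => f (g, p.2)) :=
    hf.comp (contMDiff_id.prodMk contMDiff_const)
  have hγ : HasVelocity (fun τ : ℝ => p.1 * lieExp (G := G) (τ • X)) t
      (leftField X (p.1 * lieExp (G := G) (t • X))) :=
    (isLeftCurve_lieExp (G := G) X).mul_left p.1 t
  have h1 := (hfp.mdifferentiable (by simp)
    (p.1 * lieExp (G := G) (t • X))).hasTangentMap.comp_velocity hγ rfl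
  have h2 := hasVelocity_iff_hasDerivAt.1 h1
  have h3 : ∀ Y : E, dGroup (lift H) (freeFlow H t p) Y = 0 := by
    intro Y
    have h : HasTangentMap (fun _ : G => H p.2) (freeFlow H t p).1 (0 : E →L[ℝ] ℝ) :=
      hasTangentMap_const _ _
    exact DFunLike.congr_fun h.mfderiv (leftField Y (freeFlow H t p).1)
  have h4 : ∀ Y : E, p.2 (bracketE G (grad G H p.2) Y) = 0 := by
    intro Y
    rw [← bracketL_apply]
    exact hH.apply_bracketL p.2 Y
  have h5 : cotangentBracket (lift H) f (freeFlow H t p) =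
      dGroup f (freeFlow H t p) (grad (E := E) G H p.2) := by
    have h : ∀ Y : E, dFibre f (freeFlow H t p) = Y → cotangentBracket (lift H) f (freeFlow H t p) =
        dGroup f (freeFlow H t p) (grad (E := E) G H p.2) - dGroup (lift H) (freeFlow H t p) Y +
          p.2 (bracketE G (grad G H p.2) Y) := by
      rintro Y rfl
      rfl
    obtain ⟨Y, hY⟩ : ∃ Y : E, dFibre f (freeFlow H t p) = Y := ⟨_, rfl⟩
    rw [h Y hY, h3, h4, sub_zero, add_zero]
  rw [h5]
  exact h2

end FreeFlow

/-! ### The reduced flow -/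

noncomputable section ReducedFlow

variable {E : Type*} [NormedAddCommGroup E] [NormedSpace ℝ E] [FiniteDimensional ℝ E]
  {G : Type*} [TopologicalSpace G] [ChartedSpace E G] [Group G] [LieGroup 𝓘(ℝ, E) ∞ G]
  {Gp Gm : Type*} [Group Gp] [Group Gm] {ιp : Gp →* G} {ιm : Gm →* G} {H : Dual E → ℝ}

theorem lift_act [PreconnectedSpace G] (hH : IsCasimir G H) (h : Gp × Gm) (p : Cotangent E G) :
    lift H (act ιp ιm h p) = lift H p :=
  hH.coAd _ _

theorem apply_redMap [PreconnectedSpace G] (hH : IsCasimir G H) (p : Cotangent E G) :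
    H (redMap ιp ιm p) = lift H p :=
  hH.coAd _ _

/-- The free flow commutes with the action of `G_R`. -/
theorem freeFlow_act [PreconnectedSpace G] [T2Space G] (hH : IsCasimir G H) (t : ℝ) (h : Gp × Gm)
    (p : Cotangent E G) : freeFlow H t (act ιp ιm h p) = act ιp ιm h (freeFlow H t p) := by
  refine Prod.ext ?_ rfl
  change ιp h.1 * p.1 * (ιm h.2)⁻¹ * lieExp (t • grad G H (coAd (ιm h.2) p.2)) =
    ιp h.1 * (p.1 * lieExp (t • grad G H p.2)) * (ιm h.2)⁻¹
  rw [hH.grad_coAd]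
  refine (congrArg (_ * ·) (lieExp_Ad (ιm h.2) (grad G H p.2) t)).trans ?_
  group

omit [LieGroup 𝓘(ℝ, E) ∞ G] in
theorem freeFlow_one_mem_iff (t : ℝ) (L : Dual E) :
    freeFlow H t ((1 : G), L) ∈ factorDomain E ιp ιm ↔ t ∈ factorTimes ιp ιm H L := by
  rw [mem_factorDomain]
  change 1 * lieExp (t • grad G H L) ∈ factorSet ιp ιm ↔
    lieExp (t • grad G H L) ∈ factorSet ιp ιm
  rw [one_mul]

omit [LieGroup 𝓘(ℝ, E) ∞ G] in
theorem redMap_freeFlow_one (t : ℝ) (L : Dual E) :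
    redMap ιp ιm (freeFlow H t ((1 : G), L)) = redFlow ιp ιm H t L := by
  change redMap ιp ιm (1 * lieExp (t • grad G H L), L) = redMap ιp ιm (lieExp (t • grad G H L), L)
  rw [one_mul]

theorem freeFlow_mem_iff [PreconnectedSpace G] [T2Space G] (hH : IsCasimir G H) {t : ℝ}
    {p : Cotangent E G} (hp : p ∈ factorDomain E ιp ιm) :
    freeFlow H t p ∈ factorDomain E ιp ιm ↔ t ∈ factorTimes ιp ιm H (redMap ιp ιm p) := by
  rw [← freeFlow_one_mem_iff, ← act_factor_inv hp, freeFlow_act hH, act_mem_factorDomain_iff]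

theorem zero_mem_factorTimes [T2Space G] (L : Dual E) : 0 ∈ factorTimes ιp ιm H L := by
  rw [← freeFlow_one_mem_iff, freeFlow_zero, mem_factorDomain]
  exact one_mem_factorSet

/-- `Ad*_{g₊(t)⁻¹} L = Ad*_{g₋(t)⁻¹} L`, because `exp(t dH(L)) = g₊(t) g₋(t)⁻¹` fixes `L`. -/
theorem redFlow_eq_coAd_fst [PreconnectedSpace G] [T2Space G] (hH : IsCasimir G H) {t : ℝ}
    {L : Dual E} (ht : t ∈ factorTimes ιp ιm H L) :
    redFlow ιp ιm H t L = coAd (ιp (factorCurve ιp ιm H L t).1)⁻¹ L := by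
  have h1 : lieExp (t • grad G H L) =
      ιp (factorCurve ιp ιm H L t).1 * (ιm (factorCurve ιp ιm H L t).2)⁻¹ := factor_spec ht
  have h2 := hH.coAd_lieExp L t
  rw [h1, coAd_mul] at h2
  have h3 := congrArg (coAd (ιp (factorCurve ιp ιm H L t).1)⁻¹) h2
  rw [coAd_inv_coAd] at h3
  exact h3

variable (huniq : ∀ (a a' : Gp) (b b' : Gm),
  ιp a * (ιm b)⁻¹ = ιp a' * (ιm b')⁻¹ → a = a' ∧ b = b')

include huniq

/-- The free flow descends: move `p` to the fibre over the identity, where the free flow is the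
exponential. -/
theorem redMap_freeFlow [PreconnectedSpace G] [T2Space G] (hH : IsCasimir G H) {t : ℝ}
    {p : Cotangent E G} (hp : p ∈ factorDomain E ιp ιm)
    (ht : freeFlow H t p ∈ factorDomain E ιp ιm) :
    redMap ιp ιm (freeFlow H t p) = redFlow ιp ιm H t (redMap ιp ιm p) := by
  rw [← redMap_freeFlow_one, ← act_factor_inv hp, freeFlow_act hH, redMap_act huniq _ ht]

/-- The flow property of the reduced flow, inherited from the free flow. -/
theorem redFlow_add [PreconnectedSpace G] [T2Space G] (hH : IsCasimir G H) {s t : ℝ} {L : Dual E}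
    (hs : s ∈ factorTimes ιp ιm H L) (ht : s + t ∈ factorTimes ιp ιm H L) :
    redFlow ιp ιm H (s + t) L = redFlow ιp ιm H t (redFlow ιp ιm H s L) := by
  rw [← freeFlow_one_mem_iff] at hs ht
  rw [← redMap_freeFlow_one (G := G) (s + t), ← redMap_freeFlow_one (G := G) s]
  rw [freeFlow_add] at ht ⊢
  exact redMap_freeFlow huniq hH hs ht

theorem factorCurve_zero [T2Space G] (L : Dual E) : factorCurve ιp ιm H L 0 = 1 :=
  (congrArg (factor ιp ιm) (lieExp_zero_smul (G := G) (grad G H L))).trans (factor_one huniq)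

end ReducedFlow

/-! ### The Lax equation -/

noncomputable section Lax

variable {E : Type*} [NormedAddCommGroup E] [NormedSpace ℝ E] [FiniteDimensional ℝ E]
  {G : Type*} [TopologicalSpace G] [ChartedSpace E G] [Group G] [LieGroup 𝓘(ℝ, E) ∞ G] [T2Space G]
  {Ep : Type*} [NormedAddCommGroup Ep] [NormedSpace ℝ Ep] [FiniteDimensional ℝ Ep]
  {Gp : Type*} [TopologicalSpace Gp] [ChartedSpace Ep Gp] [Group Gp] [LieGroup 𝓘(ℝ, Ep) ∞ Gp]
  {Em : Type*} [NormedAddCommGroup Em] [NormedSpace ℝ Em] [FiniteDimensional ℝ Em]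
  {Gm : Type*} [TopologicalSpace Gm] [ChartedSpace Em Gm] [Group Gm] [LieGroup 𝓘(ℝ, Em) ∞ Gm]
  {gp gm : LieSubalgebra ℝ (Alg E G)} (hc : IsCompl gp.toSubmodule gm.toSubmodule)
  {ιp : Gp →* G} {ιm : Gm →* G}
  (hp : IsLieSubgroup (F := Ep) ιp gp) (hm : IsLieSubgroup (F := Em) ιm gm)
  (huniq : ∀ (a a' : Gp) (b b' : Gm),
    ιp a * (ιm b)⁻¹ = ιp a' * (ιm b')⁻¹ → a = a' ∧ b = b')
  {H : Dual E → ℝ}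

include hc hp hm

theorem isOpen_factorTimes (L : Dual E) : IsOpen (factorTimes ιp ιm H L) :=
  (isOpen_factorSet hc hp hm).preimage (contMDiff_lieExp_smul (G := G) (grad G H L)).continuous

include huniq

theorem contMDiffOn_factorCurve (L : Dual E) :
    ContMDiffOn 𝓘(ℝ, ℝ) 𝓘(ℝ, Ep) ∞ (fun t => (factorCurve ιp ιm H L t).1)
        (factorTimes ιp ιm H L) ∧
      ContMDiffOn 𝓘(ℝ, ℝ) 𝓘(ℝ, Em) ∞ (fun t => (factorCurve ιp ιm H L t).2)
        (factorTimes ιp ιm H L) := by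
  have hexp := contMDiff_lieExp_smul (G := G) (grad G H L)
  exact ⟨fun t ht => ((contMDiffAt_factor hc hp hm huniq ht).1.comp t
      hexp.contMDiffAt).contMDiffWithinAt,
    fun t ht => ((contMDiffAt_factor hc hp hm huniq ht).2.comp t
      hexp.contMDiffAt).contMDiffWithinAt⟩

/-- The reduced flow solves `dL/dt = -⟨L, [P₋ dH(L), ·]⟩`. At time `0` this is the derivative of
the reduction map, and the flow property moves it to any other time. -/
theorem hasDerivAt_redFlow [PreconnectedSpace G] (hH : IsCasimir G H) {t : ℝ} {L : Dual E}
    (ht : t ∈ factorTimes ιp ιm H L) :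
    HasDerivAt (fun τ => redFlow ιp ιm H τ L) (-(redFlow ιp ιm H t L).comp
      (bracketL E G (projMinus hc (grad G H (redFlow ιp ιm H t L))))) t := by
  set L' := redFlow ιp ιm H t L with hL'
  have h1 : HasVelocity (fun τ => redFlow ιp ιm H τ L') 0
      (-L'.comp (bracketL E G (projMinus hc (grad G H L')))) :=
    (hasTangentMap_redMap_one hc hp hm huniq L').comp_velocity
      (hasVelocity_lieExp_zero (G := G) (grad G H L')) (lieExp_zero_smul (grad G H L'))
  have h2 := HasVelocity.comp_add (t := t) (s := -t) (by rwa [add_neg_cancel])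
  refine (hasVelocity_iff_hasDerivAt.1 h2).congr_of_eventuallyEq ?_
  filter_upwards [(isOpen_factorTimes hc hp hm L).mem_nhds ht] with τ hτ
  have := redFlow_add huniq hH (t := τ + -t) ht (by rwa [add_add_neg_cancel'_right])
  rwa [add_add_neg_cancel'_right] at this

/-- The Lax equation, for `M₊ = P₊ dH(L)` and `M₋ = -P₋ dH(L)`. The two right-hand sides agree since
`⟨L, [dH(L), ·]⟩ = 0`. -/
theorem hasDerivAt_redFlow_coad [PreconnectedSpace G] (hH : IsCasimir G H) {t : ℝ} {L : Dual E}
    (ht : t ∈ factorTimes ιp ιm H L) {M : E}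
    (hM : M = grad G H (redFlow ιp ιm H t L) -
        projMinus hc (grad G H (redFlow ιp ιm H t L)) ∨
      M = -projMinus hc (grad G H (redFlow ιp ιm H t L))) :
    HasDerivAt (fun τ => redFlow ιp ιm H τ L) (-coad (G := G) M (redFlow ιp ιm H t L)) t := by
  convert hasDerivAt_redFlow hc hp hm huniq hH ht using 1
  congr 1
  ext Y
  rw [apply_coad]
  change _ = redFlow ιp ιm H t L (bracketL E G (projMinus hc (grad G H (redFlow ιp ιm H t L))) Y)
  have h := hH.apply_bracketL (redFlow ιp ιm H t L) Y
  rcases hM with rfl | rfl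
  · rw [map_sub, sub_apply, map_sub, h, zero_sub, neg_neg]
  · rw [map_neg, neg_apply, map_neg, neg_neg]

/-- The Hamiltonian form of the reduced equation: since `⟨L, [dH(L), ·]⟩ = 0`, the bracket
`{H, φ}_R(L)` is `-⟨L, [P₋ dH(L), dφ(L)]⟩`. -/
theorem hasDerivAt_comp_redFlow [PreconnectedSpace G] (hH : IsCasimir G H) {φ : Dual E → ℝ}
    (hφ : ContDiff ℝ ∞ φ) {t : ℝ} {L : Dual E} (ht : t ∈ factorTimes ιp ιm H L) :
    HasDerivAt (fun τ => φ (redFlow ιp ιm H τ L))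
      (liePoisson (rBracket hc) H φ (redFlow ιp ιm H t L)) t := by
  have h1 := (hφ.differentiable (by simp) (redFlow ιp ιm H t L)).hasFDerivAt.comp_hasDerivAt t
    (hasDerivAt_redFlow hc hp hm huniq hH ht)
  set L' := redFlow ιp ιm H t L with hL'
  have h2 : liePoisson (rBracket hc) H φ L' =
      L' (rBracket hc (grad (E := E) G H L') (grad (E := E) G φ L') : E) := rfl
  rw [h2, apply_rBracket, hH.apply_bracketL, hH.apply_bracketL, zero_sub, sub_zero]
  rw [← apply_grad (G := G)] at h1
  exact h1

end Lax

end LieReduction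

open LieReduction in
theorem mainTheorem3
    {E : Type*} [NormedAddCommGroup E] [NormedSpace ℝ E] [FiniteDimensional ℝ E]
    {G : Type*} [TopologicalSpace G] [ChartedSpace E G] [Group G] [LieGroup 𝓘(ℝ, E) ∞ G]
    [T2Space G] [ConnectedSpace G]
    -- the Lie subgroups `G₊`, `G₋`, with Lie algebras `𝔤₊`, `𝔤₋`
    {Ep : Type*} [NormedAddCommGroup Ep] [NormedSpace ℝ Ep] [FiniteDimensional ℝ Ep]
    {Gp : Type*} [TopologicalSpace Gp] [ChartedSpace Ep Gp] [Group Gp] [LieGroup 𝓘(ℝ, Ep) ∞ Gp]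
    {Em : Type*} [NormedAddCommGroup Em] [NormedSpace ℝ Em] [FiniteDimensional ℝ Em]
    {Gm : Type*} [TopologicalSpace Gm] [ChartedSpace Em Gm] [Group Gm] [LieGroup 𝓘(ℝ, Em) ∞ Gm]
    (gp gm : LieSubalgebra ℝ (Alg E G)) (hc : IsCompl gp.toSubmodule gm.toSubmodule)
    (ιp : Gp →* G) (ιm : Gm →* G)
    (hp : IsLieSubgroup (F := Ep) ιp gp) (hm : IsLieSubgroup (F := Em) ιm gm)
    -- uniqueness in the factorisation problem `g = g₊ g₋⁻¹`
    (huniq : ∀ (a a' : Gp) (b b' : Gm), ιp a * (ιm b)⁻¹ = ιp a' * (ιm b')⁻¹ → a = a' ∧ b = b')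
    (H : Dual E → ℝ) (hH : IsCasimir G H) :
    -- (i) the lifted Hamiltonian is invariant
    (∀ (h : Gp × Gm) (p : Cotangent E G), lift H (act ιp ιm h p) = lift H p) ∧
    -- (ii) `s` is constant on orbits
    (∀ (h : Gp × Gm), ∀ p ∈ factorDomain E ιp ιm,
      act ιp ιm h p ∈ factorDomain E ιp ιm ∧ redMap ιp ιm (act ιp ιm h p) = redMap ιp ιm p) ∧
    -- (iii) `s` identifies the orbit space with `𝔤*`, as manifolds, and
    -- the quotient Poisson structure is the Lie-Poisson bracket of `𝔤_R`
    (IsOpen (factorDomain E ιp ιm) ∧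
      ContMDiffOn (𝓘(ℝ, E).prod 𝓘(ℝ, Dual E)) 𝓘(ℝ, Dual E) ∞
        (redMap ιp ιm) (factorDomain E ιp ιm) ∧
      Set.SurjOn (redMap ιp ιm) (factorDomain E ιp ιm) Set.univ ∧
      (∀ p ∈ factorDomain E ιp ιm, ∀ q ∈ factorDomain E ιp ιm,
        redMap ιp ιm p = redMap ιp ιm q ↔ ∃ h : Gp × Gm, act ιp ιm h p = q) ∧
      (∀ f : Cotangent E G → ℝ,
        ContMDiffOn (𝓘(ℝ, E).prod 𝓘(ℝ, Dual E)) 𝓘(ℝ, ℝ) ∞ f (factorDomain E ιp ιm) →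
        (∀ (h : Gp × Gm), ∀ p ∈ factorDomain E ιp ιm, f (act ιp ιm h p) = f p) →
        ∃! φ : Dual E → ℝ, ContDiff ℝ ∞ φ ∧
          ∀ p ∈ factorDomain E ιp ιm, f p = φ (redMap ιp ιm p)) ∧
      (∀ φ ψ : Dual E → ℝ, ContDiff ℝ ∞ φ → ContDiff ℝ ∞ ψ → ∀ p ∈ factorDomain E ιp ιm,
        cotangentBracket (fun q => φ (redMap ιp ιm q)) (fun q => ψ (redMap ιp ιm q)) p =
          liePoisson (rBracket hc) φ ψ (redMap ιp ιm p))) ∧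
    -- (iv) the free flow is the Hamiltonian flow of the lifted Hamiltonian
    ((∀ p : Cotangent E G, freeFlow H 0 p = p ∧
        ∀ f : Cotangent E G → ℝ,
          ContMDiff (𝓘(ℝ, E).prod 𝓘(ℝ, Dual E)) 𝓘(ℝ, ℝ) ∞ f → ∀ t : ℝ,
            HasDerivAt (fun τ => f (freeFlow H τ p))
              (cotangentBracket (lift H) f (freeFlow H t p)) t) ∧
      -- it descends along `s` to the reduced flow
      (∀ p ∈ factorDomain E ιp ιm, ∀ t : ℝ,
        (freeFlow H t p ∈ factorDomain E ιp ιm ↔ t ∈ factorTimes ιp ιm H (redMap ιp ιm p)) ∧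
        (freeFlow H t p ∈ factorDomain E ιp ιm →
          redMap ιp ιm (freeFlow H t p) = redFlow ιp ιm H t (redMap ιp ιm p))) ∧
      -- `g₊(t)`, `g₋(t)` are smooth curves starting at the identity, and solve the factorisation
      -- problem; the reduced flow is given by either of them, and satisfies the Lax equation
      (∀ L : Dual E,
        IsOpen (factorTimes ιp ιm H L) ∧ 0 ∈ factorTimes ιp ιm H L ∧
        ContMDiffOn 𝓘(ℝ, ℝ) 𝓘(ℝ, Ep) ∞
          (fun t => (factorCurve ιp ιm H L t).1) (factorTimes ιp ιm H L) ∧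
        ContMDiffOn 𝓘(ℝ, ℝ) 𝓘(ℝ, Em) ∞
          (fun t => (factorCurve ιp ιm H L t).2) (factorTimes ιp ιm H L) ∧
        factorCurve ιp ιm H L 0 = 1 ∧
        ∀ t ∈ factorTimes ιp ιm H L,
          lieExp (t • dDual G H L) =
            ιp (factorCurve ιp ιm H L t).1 * (ιm (factorCurve ιp ιm H L t).2)⁻¹ ∧
          redFlow ιp ιm H t L = coAd (ιp (factorCurve ιp ιm H L t).1)⁻¹ L ∧
          redFlow ιp ιm H t L = coAd (ιm (factorCurve ιp ιm H L t).2)⁻¹ L ∧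
          ∀ M ∈ ({(1 / 2 : ℝ) • (rMatrix hc (dDual G H (redFlow ιp ιm H t L)) +
                    dDual G H (redFlow ιp ιm H t L)),
                  (1 / 2 : ℝ) • (rMatrix hc (dDual G H (redFlow ιp ιm H t L)) -
                    dDual G H (redFlow ιp ιm H t L))} : Set (Alg E G)),
            HasDerivAt (fun τ => redFlow ιp ιm H τ L) (-coad M (redFlow ιp ιm H t L)) t)) ∧
    -- (v) the reduced Hamiltonian is `H`, and it generates the reduced flow for the bracket of `𝔤_R`
    ((∀ K : Dual E → ℝ,
        (∀ p ∈ factorDomain E ιp ιm, lift H p = K (redMap ιp ιm p)) ↔ K = H) ∧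
      ∀ φ : Dual E → ℝ, ContDiff ℝ ∞ φ → ∀ L : Dual E, ∀ t ∈ factorTimes ιp ιm H L,
        HasDerivAt (fun τ => φ (redFlow ιp ιm H τ L))
          (liePoisson (rBracket hc) H φ (redFlow ιp ιm H t L)) t) := by
  have hone : ∀ L : Dual E, ((1 : G), L) ∈ factorDomain E ιp ιm := fun L =>
    mem_factorDomain.2 one_mem_factorSet
  refine ⟨fun h p => lift_act hH h p,
    fun h p hpD => ⟨act_mem_factorDomain_iff.2 hpD, redMap_act huniq h hpD⟩,
    ⟨isOpen_factorDomain hc hp hm,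
      fun p hpD => (contMDiffAt_redMap hc hp hm huniq hpD).contMDiffWithinAt,
      fun L _ => ⟨(1, L), hone L, redMap_one huniq L⟩,
      fun p hpD q hqD => redMap_eq_iff huniq hpD hqD,
      fun f hf hinv => existsUnique_comp_redMap hc hp hm huniq hf hinv,
      fun φ ψ hφ hψ p hpD => cotangentBracket_comp_redMap hc hp hm huniq hφ hψ hpD⟩,
    ⟨fun p => ⟨freeFlow_zero p, fun f hf t => hasDerivAt_comp_freeFlow hH hf p t⟩,
      fun p hpD t => ⟨freeFlow_mem_iff hH hpD, redMap_freeFlow huniq hH hpD⟩,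
      fun L => ⟨isOpen_factorTimes hc hp hm L, zero_mem_factorTimes L,
        (contMDiffOn_factorCurve hc hp hm huniq L).1, (contMDiffOn_factorCurve hc hp hm huniq L).2,
        factorCurve_zero huniq L, fun t ht => ⟨factor_spec ht, redFlow_eq_coAd_fst hH ht, rfl,
          fun M hM => hasDerivAt_redFlow_coad hc hp hm huniq hH ht ?_⟩⟩⟩,
    fun K => ⟨fun hK => funext fun L => ?_, ?_⟩,
    fun φ hφ L t ht => hasDerivAt_comp_redFlow hc hp hm huniq hH hφ ht⟩
  · rcases hM with rfl | rfl
    · exact .inl (half_smul_rMatrix_add hc _)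
    · exact .inr (half_smul_rMatrix_sub hc _)
  · rw [← redMap_one (ιp := ιp) (ιm := ιm) huniq L, ← hK _ (hone L), apply_redMap hH]
  · rintro rfl p -
    exact (apply_redMap hH p).symm
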